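/- Let $\varepsilon>4$ be real and $\lambda\in\mathbb{C}$. Let $$\Gamma_\varepsilon=\{(x,y)\in\mathbb{C}^2 : \cos 2\pi x+\cos 2\pi y=\varepsilon/2\},$$ a smooth complex curve, and let $q\colon\Gamma_\varepsilon\to\{(u,v)\in(\mathbb{C}\setminus\{0\})^2 : u+u^{-1}+v+v^{-1}=\varepsilon\}$, $q(x,y)=(e^{2\pi i x},e^{2\pi i y})$, be the covering of the affine elliptic curve. On $\Gamma_\varepsilon$ consider the holomorphic 1-form $$\theta_\lambda=\Bigl(x+\frac{\lambda}{\sin 2\pi x}\Bigr)\,dy,$$ where $\frac{dy}{\sin 2\pi x}$ is understood as $-\frac{dx}{\sin 2\pi y}$ at the points with $\sin 2\pi x=0$. Fix a base point $P_0\in\Gamma_\varepsilon$, let $p\colon\tilde\Gamma_\varepsilon\to\Gamma_\varepsilon$ be the universal covering given by the homotopy classes (with fixed end points) of paths in $\Gamma_\varepsilon$ starting at $P_0$, with $p$ the end point, and define $$g_{\lambda,\varepsilon}\colon\tilde\Gamma_\varepsilon\to\mathbb{C}\setminus\{0\},\qquad g_{\lambda,\varepsilon}(\gamma)=e^{2\pi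 i\int_\gamma\theta_\lambda},$$ the integral being taken along any piecewise $C^1$ path in the class. Assume that $g_{\lambda,\varepsilon}(\gamma)=1$ for every $\gamma\in\tilde\Gamma_\varepsilon$ for which both $x\circ\gamma$ and $q\circ\gamma$ are closed paths. Then there exists a holomorphic function $f\colon\Gamma_\varepsilon\to\mathbb{C}$ such that $$f(x+1,y)\,e^{-2\pi i y}=f(x,y+1)=f(x,y)\qquad\text{for all }(x,y)\in\Gamma_\varepsilon$$ (a Bloch–Jost function), and $g_{\lambda,\varepsilon}=f\circ p$. -/

import Mathlib

open Complex Topology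

noncomputable section

/-- The spectral curve `Γ_ε = {(x, y) ∈ ℂ² | cos 2πx + cos 2πy = ε / 2}`. -/
def spectralCurve (ε : ℝ) : Set (ℂ × ℂ) :=
  {P | cos (2 * Real.pi * P.1) + cos (2 * Real.pi * P.2) = (ε : ℂ) / 2}

/-- The affine part of the elliptic curve, `{(u, v) | u + u⁻¹ + v + v⁻¹ = ε}`, with `u, v ≠ 0`. -/
def ellipticCurve (ε : ℝ) : Set (ℂ × ℂ) :=
  {w | w.1 ≠ 0 ∧ w.2 ≠ 0 ∧ w.1 + w.1⁻¹ + w.2 + w.2⁻¹ = (ε : ℂ)}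

/-- The covering `q : Γ_ε → {u + u⁻¹ + v + v⁻¹ = ε}`, `(x, y) ↦ (e^{2πix}, e^{2πiy})`. -/
def qMap {ε : ℝ} (P : spectralCurve ε) : ellipticCurve ε :=
  ⟨(exp (2 * Real.pi * I * P.1.1), exp (2 * Real.pi * I * P.1.2)), by
    refine ⟨exp_ne_zero _, exp_ne_zero _, ?_⟩
    have h : cos (2 * Real.pi * P.1.1) + cos (2 * Real.pi * P.1.2) = (ε : ℂ) / 2 := P.2
    have e : ∀ z : ℂ, exp (2 * Real.pi * I * z) + (exp (2 * Real.pi * I * z))⁻¹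
        = 2 * cos (2 * Real.pi * z) := fun z => by
      rw [two_cos, ← exp_neg]
      congr 2 <;> ring
    have e1 := e P.1.1
    have e2 := e P.1.2
    dsimp only
    linear_combination e1 + e2 + 2 * h⟩

/-- The automorphism `(x, y) ↦ (x + 1, y)` of the spectral curve. -/
def shiftX {ε : ℝ} (P : spectralCurve ε) : spectralCurve ε :=
  ⟨(P.1.1 + 1, P.1.2), by
    have h : cos (2 * Real.pi * P.1.1) + cos (2 * Real.pi * P.1.2) = (ε : ℂ) / 2 := P.2
    simpa [spectralCurve, mul_add, cos_add_two_pi] using h⟩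

/-- The automorphism `(x, y) ↦ (x, y + 1)` of the spectral curve. -/
def shiftY {ε : ℝ} (P : spectralCurve ε) : spectralCurve ε :=
  ⟨(P.1.1, P.1.2 + 1), by
    have h : cos (2 * Real.pi * P.1.1) + cos (2 * Real.pi * P.1.2) = (ε : ℂ) / 2 := P.2
    simpa [spectralCurve, mul_add, cos_add_two_pi] using h⟩

open Classical in
/-- The holomorphic 1-form `dy / sin 2πx = - dx / sin 2πy` on the spectral curve. The two
expressions agree on tangent vectors of the curve wherever both make sense, and for `ε > 4` the two
sines have no common zero on the curve, so that one of them always applies. -/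
def omegaForm (P : ℂ × ℂ) : ℂ × ℂ →L[ℂ] ℂ :=
  if sin (2 * Real.pi * P.1) = 0 then
    -((sin (2 * Real.pi * P.2))⁻¹ • ContinuousLinearMap.fst ℂ ℂ ℂ)
  else (sin (2 * Real.pi * P.1))⁻¹ • ContinuousLinearMap.snd ℂ ℂ ℂ

/-- The deformed symplectic potential `θ_λ = (x + λ / sin 2πx) dy` as a holomorphic 1-form on the
spectral curve. -/
def thetaForm (lam : ℂ) (P : ℂ × ℂ) : ℂ × ℂ →L[ℂ] ℂ :=
  P.1 • ContinuousLinearMap.snd ℂ ℂ ℂ + lam • omegaForm P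

/-- A path in the spectral curve, regarded as a path in `ℂ²`. -/
def toAmbient {ε : ℝ} {P Q : spectralCurve ε} (γ : Path P Q) : Path (P : ℂ × ℂ) (Q : ℂ × ℂ) :=
  γ.map continuous_subtype_val

/-- A piecewise `C¹` path in `ℂ²`: it is `C¹` on each of the closed intervals of some
subdivision `0 = t₀ ≤ t₁ ≤ ⋯ ≤ tₙ = 1`. -/
def IsPiecewiseC1 {a b : ℂ × ℂ} (γ : Path a b) : Prop :=
  ∃ (n : ℕ) (t : ℕ → ℝ), Monotone t ∧ t 0 = 0 ∧ t n = 1 ∧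
    ∀ i < n, ContDiffOn ℝ 1 γ.extend (Set.Icc (t i) (t (i + 1)))

/-- The universal covering of `Γ_ε`: homotopy classes (with fixed end points) of all paths in
`Γ_ε` starting from the base point `P₀`. The projection `p` is `Sigma.fst`, the end point. -/
def UniversalCover {ε : ℝ} (P₀ : spectralCurve ε) : Type :=
  Σ P : spectralCurve ε, Path.Homotopic.Quotient P₀ P

/-- The covering projection `p : Γ̃_ε → Γ_ε`, the end point of a class of paths. -/
def coverProj {ε : ℝ} {P₀ : spectralCurve ε} (z : UniversalCover P₀) : spectralCurve ε := z.1

/-- `w = e^{2πi ∫_γ θ_λ}` for some piecewise `C¹` path `γ` in the homotopy class `z`. -/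
def IsExpPeriod (lam : ℂ) {ε : ℝ} {P₀ : spectralCurve ε} (z : UniversalCover P₀) (w : ℂ) : Prop :=
  ∃ γ : Path P₀ z.1, Path.Homotopic.Quotient.mk γ = z.2 ∧ IsPiecewiseC1 (toAmbient γ) ∧
    w = exp (2 * Real.pi * I * curveIntegral (thetaForm lam) (toAmbient γ))

open Classical in
/-- The function `g_{λ,ε} : Γ̃_ε → ℂ_{≠0}`, `γ ↦ e^{2πi ∫_γ θ_λ}`: its value at a homotopy class is
the common value of `e^{2πi ∫_γ θ_λ}` over all piecewise `C¹` paths `γ` in the class. (For `ε > 4`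
the form is closed on the curve, so that there is exactly one such value, and it is non-zero; the
value `0` would stand for an ill-defined one.) -/
def expPeriod (lam : ℂ) {ε : ℝ} {P₀ : spectralCurve ε} (z : UniversalCover P₀) : ℂ :=
  if h : ∃! w, IsExpPeriod lam z w then h.choose else 0

/-- `f : Γ_ε → ℂ` is holomorphic: near every point of the (smooth, for `ε > 4`) curve it is the
restriction of a holomorphic function of two variables. -/
def IsHolomorphicOnCurve {ε : ℝ} (f : spectralCurve ε → ℂ) : Prop :=
  ∀ P : spectralCurve ε, ∃ F : ℂ × ℂ → ℂ,
    AnalyticAt ℂ F (P : ℂ × ℂ) ∧ ∀ᶠ Q : spectralCurve ε in 𝓝 P, f Q = F (Q : ℂ × ℂ)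

/-- Bloch–Jost functions: holomorphic `f : Γ_ε → ℂ` with
`f (x + 1, y) e^{-2πiy} = f (x, y + 1) = f (x, y)`. -/
structure IsBlochJost {ε : ℝ} (f : spectralCurve ε → ℂ) : Prop where
  holomorphic : IsHolomorphicOnCurve f
  shift_x : ∀ P : spectralCurve ε,
    f (shiftX P) * exp (-(2 * Real.pi * I * P.1.2)) = f (shiftY P)
  shift_y : ∀ P : spectralCurve ε, f (shiftY P) = f P

end

/-! Since θ_λ is a holomorphic 1-form on a smooth curve, it has local primitives, so its period
along any continuous path is defined and invariant under homotopy. It agrees with the curve integral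
on piecewise C¹ paths (`curveIntegral_eq_period`), and every path is homotopic to such a path
(`hasC1Representative`). Hence g is the exponential of 2πi times the period (`expPeriod_eq`).

The hypothesis is used for loops at P₀ and for paths from P₀ to its y-translate. The loops make the
exponential depend only on the end point, which defines f. For a path β from Q to its y-translate,
join P₀ to Q by α and apply the hypothesis to α, β and the reversed y-translate of α. Since θ_λ is
invariant under y ↦ y + 1, the two copies of α cancel, so β has integral period. This holds for
every Q, because the curve is connected (`joined_spectralCurve`).

The x-translation is not covered by the hypothesis. The swap (x, y) ↦ (y, x) reverses the sign of dy
/ sin 2πx, so θ_λ and its pullback under the swap add up to d(xy) (`period_map_swapCurve`). The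
period from P₀ = (x₀, y₀) to its x-translate is therefore y₀ minus the period of a path from (y₀,
x₀) to its y-translate, that is, y₀ modulo integers. As translating x by 1 adds dy to θ_λ, this
gives the factor e^{2πiy} at every point. -/

noncomputable section

/-! ### Periods along continuous paths from local primitives -/

open Filter Set unitInterval

/-- The complex numbers with the discrete topology. -/
def DiscreteComplex : Type := ℂ

instance : AddCommGroup DiscreteComplex := inferInstanceAs (AddCommGroup ℂ)
instance : TopologicalSpace DiscreteComplex := ⊥
instance : DiscreteTopology DiscreteComplex := ⟨rfl⟩

/-- A notion of local primitive, to be thought of as that of a fixed closed 1-form on `X`. -/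
structure PrimitiveSystem (X : Type*) [TopologicalSpace X] where
  /-- `F` is a primitive near `x`. -/
  IsPrim : X → (X → ℂ) → Prop
  exists_isPrim : ∀ x, ∃ F, IsPrim x F
  eventually_isPrim : ∀ {x F}, IsPrim x F → ∀ᶠ y in 𝓝 x, IsPrim y F
  eventually_sub_eq : ∀ {x F F'}, IsPrim x F → IsPrim x F' →
    ∀ᶠ y in 𝓝 x, F y - F' y = F x - F' x

namespace PrimitiveSystem

variable {X : Type*} [TopologicalSpace X] (A : PrimitiveSystem X)

/-- A primitive of the form along a path. -/
def IsPrimAlong (γ : I → X) (G : I → ℂ) : Prop :=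
  ∀ t, ∃ F, A.IsPrim (γ t) F ∧ ∀ᶠ s in 𝓝 t, G s - G t = F (γ s) - F (γ t)

variable {A}

theorem IsPrimAlong.eventually {γ : I → X} (hγ : Continuous γ) {G : I → ℂ}
    (h : A.IsPrimAlong γ G) {t : I} {F : X → ℂ} (hF : A.IsPrim (γ t) F) :
    ∀ᶠ s in 𝓝 t, G s - G t = F (γ s) - F (γ t) := by
  obtain ⟨F', hF', h'⟩ := h t
  have := hγ.continuousAt.eventually (A.eventually_sub_eq hF hF')
  filter_upwards [h', this] with s h1 h2
  linear_combination h1 - h2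

/-- The difference of two primitives along the same path is locally constant on a connected
interval. -/
theorem IsPrimAlong.sub_eq {γ : I → X} (hγ : Continuous γ) {G G' : I → ℂ}
    (h : A.IsPrimAlong γ G) (h' : A.IsPrimAlong γ G') : G 1 - G 0 = G' 1 - G' 0 := by
  have : IsLocallyConstant fun t => G t - G' t := by
    rw [IsLocallyConstant.iff_eventually_eq]
    intro t
    obtain ⟨F, hF, hG⟩ := h t
    filter_upwards [hG, h'.eventually hγ hF] with s h1 h2
    linear_combination h1 - h2
  have := this.apply_eq_of_isPreconnected (isPreconnected_univ (α := I)) (mem_univ 1) (mem_univ 0)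
  linear_combination this

variable (A)

/-- The bundle of germs of primitives, trivialized over the domains of the primitives. -/
def germCore : FiberBundleCore (X → ℂ) X DiscreteComplex where
  baseSet F := {x | A.IsPrim x F}
  isOpen_baseSet F := isOpen_iff_mem_nhds.2 fun _ hx => A.eventually_isPrim hx
  indexAt x := (A.exists_isPrim x).choose
  mem_baseSet_at x := (A.exists_isPrim x).choose_spec
  coordChange F F' x v := v + (show DiscreteComplex from F x - F' x)
  coordChange_self F x _ v := by
    have : (show DiscreteComplex from F x - F x) = 0 := sub_self (F x)
    rw [this, add_zero]
  -- Two primitives differ by a locally constant function, so the transition maps are continuous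
  -- even for the discrete topology on the fibre.
  continuousOn_coordChange F F' := by
    rintro ⟨x, v⟩ ⟨⟨hx, hx'⟩, -⟩
    refine ContinuousAt.continuousWithinAt ?_
    have h1 : ∀ᶠ p : X × DiscreteComplex in 𝓝 (x, v), F p.1 - F' p.1 = F x - F' x :=
      continuousAt_fst.eventually (A.eventually_sub_eq hx hx')
    have h2 : ∀ᶠ p : X × DiscreteComplex in 𝓝 (x, v), p.2 = v :=
      continuousAt_snd.eventually (p := fun w => w = v) (by simp [nhds_discrete])
    refine continuousAt_const (y := v + (show DiscreteComplex from F x - F' x)) |>.congr ?_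
    filter_upwards [h1, h2] with p hp1 hp2
    rw [hp1, hp2]
  coordChange_comp F F' F'' x _ v := by
    have : (F x - F' x) + (F' x - F'' x) = F x - F'' x := by ring
    rw [add_assoc]
    exact congrArg (fun w : DiscreteComplex => v + w) this

/-- The value of a germ of a primitive at its base point. -/
def germValue (e : A.germCore.TotalSpace) : ℂ :=
  (show ℂ from e.2) + (A.exists_isPrim e.1).choose e.1

theorem isCoveringMap_germCore : IsCoveringMap A.germCore.proj :=
  FiberBundle.isCoveringMap (F := DiscreteComplex) (E := A.germCore.Fiber)

/-- In the trivialization given by F, the discrete coordinate of a germ is its value minus F; being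
continuous, it is locally constant. -/
theorem eventually_germValue (e : A.germCore.TotalSpace) {F : X → ℂ} (hF : A.IsPrim e.1 F) :
    ∀ᶠ e' in 𝓝 e, A.germValue e' - A.germValue e = F e'.1 - F e.1 := by
  set T := A.germCore.localTriv F
  have he : e ∈ T.source := hF
  have hc : ContinuousAt T e := T.continuousOn.continuousAt (T.open_source.mem_nhds he)
  have key : ∀ e', (show ℂ from (T e').2) = A.germValue e' - F e'.1 := by
    intro e'
    change (show ℂ from e'.2) + ((A.exists_isPrim e'.1).choose e'.1 - F e'.1) = _
    rw [germValue]; ring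
  have h2 : ∀ᶠ e' in 𝓝 e, (T e').2 = (T e).2 :=
    (continuousAt_snd.comp hc).eventually (p := fun w => w = (T e).2) (by simp [nhds_discrete])
  filter_upwards [h2] with e' h'
  have h3 : (show ℂ from (T e').2) = (show ℂ from (T e).2) := h'
  rw [key, key] at h3
  linear_combination h3

theorem isPrimAlong_germValue (Γ : C(I, A.germCore.TotalSpace)) :
    A.IsPrimAlong (A.germCore.proj ∘ Γ) (fun t => A.germValue (Γ t)) := by
  intro t
  obtain ⟨F, hF⟩ := A.exists_isPrim (Γ t).1
  exact ⟨F, hF, Γ.continuous.continuousAt.eventually (A.eventually_germValue _ hF)⟩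

theorem exists_proj_eq (x : X) : ∃ e : A.germCore.TotalSpace, x = A.germCore.proj e :=
  ⟨⟨x, (0 : DiscreteComplex)⟩, rfl⟩

/-- A lift of the path to the covering space of germs, read off by `germValue`, is a primitive along
the path. -/
theorem exists_isPrimAlong (γ : C(I, X)) : ∃ G, A.IsPrimAlong γ G := by
  obtain ⟨e, he⟩ := A.exists_proj_eq (γ 0)
  have := A.isPrimAlong_germValue (A.isCoveringMap_germCore.liftPath γ e he)
  rw [A.isCoveringMap_germCore.liftPath_lifts] at this
  exact ⟨_, this⟩

/-- The integral of the form along a continuous path. -/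
def period {x y : X} (γ : Path x y) : ℂ :=
  (A.exists_isPrimAlong γ).choose 1 - (A.exists_isPrimAlong γ).choose 0

variable {A} {x y z : X}

theorem IsPrimAlong.period_eq {γ : Path x y} {G : I → ℂ} (h : A.IsPrimAlong γ G) :
    A.period γ = G 1 - G 0 :=
  (A.exists_isPrimAlong γ).choose_spec.sub_eq γ.continuous h

/-- Lifts of homotopic paths from the same germ end at the same germ. -/
theorem period_eq_of_homotopic {γ γ' : Path x y} (h : γ.Homotopic γ') :
    A.period γ = A.period γ' := by
  obtain ⟨e, he⟩ := A.exists_proj_eq x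
  have cov := A.isCoveringMap_germCore
  have h0 : (γ : C(I, X)) 0 = A.germCore.proj e := by simpa using he
  have h0' : (γ' : C(I, X)) 0 = A.germCore.proj e := by simpa using he
  have h1 := A.isPrimAlong_germValue (cov.liftPath γ e h0)
  have h1' := A.isPrimAlong_germValue (cov.liftPath γ' e h0')
  rw [cov.liftPath_lifts] at h1 h1'
  have key : cov.liftPath (γ : C(I, X)) e h0 1 = cov.liftPath (γ' : C(I, X)) e h0' 1 :=
    cov.liftPath_apply_one_eq_of_homotopicRel h e h0 h0'
  rw [h1.period_eq, h1'.period_eq, cov.liftPath_zero, cov.liftPath_zero, key]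

theorem IsPrimAlong.comp {γ : I → X} {G : I → ℂ} (h : A.IsPrimAlong γ G) {φ : I → I}
    (hφ : Continuous φ) : A.IsPrimAlong (γ ∘ φ) (G ∘ φ) := by
  intro t
  obtain ⟨F, hF, hG⟩ := h (φ t)
  exact ⟨F, hF, hφ.continuousAt.eventually hG⟩

theorem period_symm (γ : Path x y) : A.period γ.symm = -A.period γ := by
  obtain ⟨G, hG⟩ := A.exists_isPrimAlong γ
  have : A.IsPrimAlong γ.symm (G ∘ σ) := hG.comp continuous_symm
  rw [hG.period_eq, this.period_eq]
  simp

theorem period_trans (γ : Path x y) (γ' : Path y z) :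
    A.period (γ.trans γ') = A.period γ + A.period γ' := by
  obtain ⟨G, hG⟩ := A.exists_isPrimAlong (γ.trans γ')
  -- A primitive along the concatenation restricts, through these two half-interval maps, to a
  -- primitive along each factor.
  let φ : I → I := fun t => ⟨t / 2, by constructor <;> linarith [t.2.1, t.2.2]⟩
  let ψ : I → I := fun t => ⟨(1 + t) / 2, by constructor <;> linarith [t.2.1, t.2.2]⟩
  have hφ : Continuous φ := by fun_prop
  have hψ : Continuous ψ := by fun_prop
  have e1 : (γ.trans γ') ∘ φ = γ := by
    ext t
    have h : (t : ℝ) / 2 ≤ 1 / 2 := by linarith [t.2.2]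
    simp only [Function.comp_apply, Path.trans_apply, φ, h, dite_true]
    congr 1
    exact Subtype.ext (by simp; ring)
  have e2 : (γ.trans γ') ∘ ψ = γ' := by
    ext t
    rw [Function.comp_apply, Path.trans_apply]
    split_ifs with h
    · have ht : t = 0 := Subtype.ext (by
        have h' : (1 + (t : ℝ)) / 2 ≤ 1 / 2 := h
        have := t.2.1
        exact le_antisymm (by rw [Icc.coe_zero]; linarith) this)
      subst ht
      have : (⟨2 * (ψ 0 : ℝ), (mul_pos_mem_iff zero_lt_two).2 ⟨(ψ 0).2.1, h⟩⟩ : I) = 1 :=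
        Subtype.ext (by simp [ψ])
      rw [this]; simp
    · congr 1
      exact Subtype.ext (by simp [ψ]; ring)
  have h1 := hG.comp hφ
  have h2 := hG.comp hψ
  have h1' : A.IsPrimAlong γ (G ∘ φ) := by rw [← e1]; exact h1
  have h2' : A.IsPrimAlong γ' (G ∘ ψ) := by rw [← e2]; exact h2
  rw [hG.period_eq, h1'.period_eq, h2'.period_eq]
  have a1 : φ 1 = ψ 0 := Subtype.ext (by simp [φ, ψ])
  have a2 : φ 0 = 0 := Subtype.ext (by simp [φ])
  have a3 : ψ 1 = 1 := Subtype.ext (by simp [ψ])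
  simp only [Function.comp_apply, a1, a2, a3]
  ring

theorem period_eq_of_forall_isPrim (γ : Path x y) {F : X → ℂ} (h : ∀ t, A.IsPrim (γ t) F) :
    A.period γ = F y - F x := by
  have : A.IsPrimAlong γ (F ∘ γ) := fun t => ⟨F, h t, Eventually.of_forall fun _ => rfl⟩
  rw [this.period_eq]
  simp

/-- Hypothesis `H` expresses, on primitives, that the form equals c times its pullback under φ plus
dh. -/
theorem period_eq_of_map {φ : X → X} (hφ : Continuous φ) {c : ℂ} {h : X → ℂ}
    (H : ∀ x F, A.IsPrim (φ x) F → A.IsPrim x fun y => c * F (φ y) + h y) (γ : Path x y) :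
    A.period γ = c * A.period (γ.map hφ) + h y - h x := by
  obtain ⟨G, hG⟩ := A.exists_isPrimAlong (γ.map hφ)
  have : A.IsPrimAlong γ (fun t => c * G t + h (γ t)) := by
    intro t
    obtain ⟨F, hF, hG'⟩ := hG t
    refine ⟨_, H _ F hF, hG'.mono fun s hs => ?_⟩
    change G s - G t = F (φ (γ s)) - F (φ (γ t)) at hs
    linear_combination c * hs
  rw [hG.period_eq, this.period_eq]
  simp
  ring

end PrimitiveSystem

end

/-! ### Holomorphic charts of the spectral curve -/

noncomputable section

open Filter Set

theorem mem_spectralCurve {ε : ℝ} {Q : ℂ × ℂ} : Q ∈ spectralCurve ε ↔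
    cos (2 * Real.pi * Q.1) + cos (2 * Real.pi * Q.2) = (ε : ℂ) / 2 := Iff.rfl

theorem swap_mem_spectralCurve {ε : ℝ} {Q : ℂ × ℂ} (hQ : Q ∈ spectralCurve ε) :
    Q.swap ∈ spectralCurve ε := by
  rw [mem_spectralCurve] at *
  rw [← hQ, add_comm, Prod.fst_swap, Prod.snd_swap]

theorem two_pi_ne_zero' : (2 * Real.pi : ℂ) ≠ 0 := by
  simp [Real.pi_ne_zero]

theorem cos_eq_one_or_of_sin_eq_zero {z : ℂ} (h : sin z = 0) : cos z = 1 ∨ cos z = -1 := by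
  have := sin_sq_add_cos_sq z
  rw [h] at this
  exact sq_eq_one_iff.1 (by linear_combination this)

/-- Smoothness of the curve: at a common zero both cosines are ±1, and their sum is at most 2 < ε /
2. -/
theorem sin_ne_zero_or {ε : ℝ} (hε : 4 < ε) {Q : ℂ × ℂ} (hQ : Q ∈ spectralCurve ε) :
    sin (2 * Real.pi * Q.1) ≠ 0 ∨ sin (2 * Real.pi * Q.2) ≠ 0 := by
  by_contra! h
  rw [mem_spectralCurve] at hQ
  rcases cos_eq_one_or_of_sin_eq_zero h.1 with h1 | h1 <;>
  rcases cos_eq_one_or_of_sin_eq_zero h.2 with h2 | h2 <;>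
  · rw [h1, h2] at hQ
    have := congrArg re hQ
    norm_num at this
    linarith

theorem hasDerivAt_cos_two_pi (x : ℂ) :
    HasDerivAt (fun x : ℂ => cos (2 * Real.pi * x)) (-(2 * Real.pi * sin (2 * Real.pi * x))) x := by
  have := ((hasDerivAt_id x).const_mul (2 * Real.pi : ℂ)).ccos
  simp only [id] at this
  convert this using 1
  ring

/-- Near a point with `sin 2πx ≠ 0` the spectral curve is a graph over the `y`-line. -/
theorem exists_graph {ε : ℝ} {P : ℂ × ℂ} (hP : P ∈ spectralCurve ε)
    (hs : sin (2 * Real.pi * P.1) ≠ 0) :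
    ∃ (ξ : ℂ → ℂ) (r : ℝ) (W : Set ℂ), 0 < r ∧ IsOpen W ∧ P.1 ∈ W ∧
      DifferentiableOn ℂ ξ (Metric.ball 0 r) ∧
      (∀ z ∈ Metric.ball 0 r, sin (2 * Real.pi * ξ z) ≠ 0 ∧ ξ z ∈ W ∧
        (ξ z, P.2 + z) ∈ spectralCurve ε) ∧
      (∀ Q ∈ spectralCurve ε, Q.1 ∈ W → Q.2 - P.2 ∈ Metric.ball 0 r → ξ (Q.2 - P.2) = Q.1) := by
  set φ : ℂ → ℂ := fun x => cos (2 * Real.pi * x) with hφ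
  have hφc : ∀ x, ContDiffAt ℂ 1 φ x := fun x =>
    (contDiff_cos.comp (contDiff_const.mul contDiff_id)).contDiffAt
  have hd : -(2 * Real.pi * sin (2 * Real.pi * P.1)) ≠ 0 :=
    neg_ne_zero.2 (mul_ne_zero two_pi_ne_zero' hs)
  have hφ' : HasFDerivAt φ ((ContinuousLinearEquiv.unitsEquivAut ℂ (Units.mk0 _ hd) : ℂ ≃L[ℂ] ℂ) :
      ℂ →L[ℂ] ℂ) P.1 := by
    have := (hasDerivAt_cos_two_pi P.1).hasFDerivAt
    convert! this using 1
  set e := (hφc P.1).toOpenPartialHomeomorph φ hφ' one_ne_zero with he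
  have hesrc : P.1 ∈ e.source := (hφc P.1).mem_toOpenPartialHomeomorph_source hφ' one_ne_zero
  have hecoe : ∀ x, e x = φ x := fun x =>
    congrFun ((hφc P.1).toOpenPartialHomeomorph_coe hφ' one_ne_zero) x
  -- This is the value that cos 2πx must take over the ordinate P.2 + z; the graph is the local
  -- inverse of the cosine composed with it.
  set w : ℂ → ℂ := fun z => (ε : ℂ) / 2 - φ (P.2 + z) with hw
  have hw0 : w 0 = φ P.1 := by
    rw [mem_spectralCurve] at hP
    simp only [hw, hφ, add_zero]
    linear_combination -hP
  have hwd : Differentiable ℂ w := fun z =>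
    ((hasDerivAt_cos_two_pi (P.2 + z)).differentiableAt.comp z
      (differentiableAt_id.const_add P.2)).const_sub _
  have hsymm : e.symm (φ P.1) = P.1 := by rw [← hecoe]; exact e.left_inv hesrc
  have htgt : φ P.1 ∈ e.target := by rw [← hecoe]; exact e.map_source hesrc
  have hsd : ContDiffAt ℂ 1 e.symm (φ P.1) := by
    refine e.contDiffAt_symm_deriv hd htgt ?_ ?_
    · rw [hsymm, show (e : ℂ → ℂ) = φ from funext hecoe]; exact hasDerivAt_cos_two_pi P.1
    · rw [hsymm, show (e : ℂ → ℂ) = φ from funext hecoe]; exact hφc _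
  have ev1 : ∀ᶠ v in 𝓝 (φ P.1), DifferentiableAt ℂ e.symm v :=
    (hsd.eventually (by simp)).mono fun v hv => hv.differentiableAt one_ne_zero
  have ev2 : ∀ᶠ v in 𝓝 (φ P.1), v ∈ e.target := e.open_target.mem_nhds htgt
  have ev3 : ∀ᶠ v in 𝓝 (φ P.1), sin (2 * Real.pi * e.symm v) ≠ 0 := by
    have : ContinuousAt (fun v => sin (2 * Real.pi * e.symm v)) (φ P.1) :=
      continuous_sin.continuousAt.comp (continuousAt_const.mul hsd.continuousAt)
    exact this.eventually_ne (by rwa [hsymm])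
  have hwt : Tendsto w (𝓝 0) (𝓝 (φ P.1)) := by
    have := hwd.continuous.continuousAt (x := 0)
    rwa [ContinuousAt, hw0] at this
  obtain ⟨r, hr, hball⟩ := Metric.eventually_nhds_iff_ball.1
    (hwt.eventually (ev1.and (ev2.and ev3)))
  refine ⟨fun z => e.symm (w z), r, e.source, hr, e.open_source, hesrc, ?_, ?_, ?_⟩
  · intro z hz
    exact ((hball z hz).1.comp z (hwd z)).differentiableWithinAt
  · intro z hz
    obtain ⟨-, h2, h3⟩ := hball z hz
    refine ⟨h3, e.map_target h2, ?_⟩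
    have : φ (e.symm (w z)) = w z := by rw [← hecoe]; exact e.right_inv h2
    rw [mem_spectralCurve]
    change φ (e.symm (w z)) + φ (P.2 + z) = _
    rw [this, hw]; ring
  · intro Q hQ hQ1 hQ2
    rw [mem_spectralCurve] at hQ
    have : w (Q.2 - P.2) = e Q.1 := by
      rw [hecoe]
      simp only [hw, hφ, add_sub_cancel]
      linear_combination -hQ
    simp only [this]
    exact e.left_inv hQ1

/-- A holomorphic parametrization `c` of the spectral curve near `P`, with inverse `pr`, in which
the form `θ_λ` reads `ω(z) dz`. -/
structure IsCurveChart (ε : ℝ) (lam : ℂ) (P : ℂ × ℂ) (c : ℂ → ℂ × ℂ) (pr : ℂ × ℂ → ℂ) (r : ℝ)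
    (V : Set (ℂ × ℂ)) (ω : ℂ → ℂ) : Prop where
  pos : 0 < r
  isOpen : IsOpen V
  mem : P ∈ V
  differentiableOn : DifferentiableOn ℂ c (Metric.ball 0 r)
  analyticAt_pr : ∀ Q, AnalyticAt ℂ pr Q
  map_mem : ∀ z ∈ Metric.ball 0 r, c z ∈ spectralCurve ε
  map_mem_dom : ∀ z ∈ Metric.ball 0 r, c z ∈ V
  pr_map : ∀ z ∈ Metric.ball 0 r, pr (c z) = z
  pr_mem : ∀ Q ∈ V, pr Q ∈ Metric.ball 0 r
  map_pr : ∀ Q ∈ V, Q ∈ spectralCurve ε → c (pr Q) = Q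
  pr_self : pr P = 0
  differentiableOn_form : DifferentiableOn ℂ ω (Metric.ball 0 r)
  form_eq : ∀ z ∈ Metric.ball 0 r, thetaForm lam (c z) (deriv c z) = ω z

theorem thetaForm_of_sin_ne_zero (lam : ℂ) {P : ℂ × ℂ} (hs : sin (2 * Real.pi * P.1) ≠ 0)
    (v : ℂ × ℂ) :
    thetaForm lam P v = P.1 * v.2 + lam * (v.2 / sin (2 * Real.pi * P.1)) := by
  simp [thetaForm, omegaForm, hs, div_eq_inv_mul]

theorem thetaForm_of_sin_snd_ne_zero (lam : ℂ) {P : ℂ × ℂ} (hs : sin (2 * Real.pi * P.2) ≠ 0)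
    {v : ℂ × ℂ} (hv : sin (2 * Real.pi * P.1) * v.1 + sin (2 * Real.pi * P.2) * v.2 = 0) :
    thetaForm lam P v = P.1 * v.2 - lam * (v.1 / sin (2 * Real.pi * P.2)) := by
  by_cases h : sin (2 * Real.pi * P.1) = 0
  · simp [thetaForm, omegaForm, h, div_eq_inv_mul, sub_eq_add_neg]
  · rw [thetaForm_of_sin_ne_zero lam h]
    have : v.2 / sin (2 * Real.pi * P.1) = -(v.1 / sin (2 * Real.pi * P.2)) := by
      field_simp
      linear_combination hv
    rw [this]; ring

/-- Differentiate the equation of the curve. The field is left general because the relation serves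
both complex charts and real paths. -/
theorem tangent_eq_zero {𝕜 : Type*} [RCLike 𝕜] [NormedAlgebra 𝕜 ℂ] {ε : ℝ} {u : 𝕜 → ℂ × ℂ}
    {v : ℂ × ℂ} {s : Set 𝕜} {t : 𝕜} (hs : UniqueDiffWithinAt 𝕜 s t) (ht : t ∈ s)
    (hu : ∀ τ ∈ s, u τ ∈ spectralCurve ε) (hd : HasDerivWithinAt u v s t) :
    sin (2 * Real.pi * (u t).1) * v.1 + sin (2 * Real.pi * (u t).2) * v.2 = 0 := by
  have h1 : HasDerivWithinAt (fun τ => (u τ).1) v.1 s t :=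
    (ContinuousLinearMap.fst 𝕜 ℂ ℂ).hasFDerivAt.comp_hasDerivWithinAt t hd
  have h2 : HasDerivWithinAt (fun τ => (u τ).2) v.2 s t :=
    (ContinuousLinearMap.snd 𝕜 ℂ ℂ).hasFDerivAt.comp_hasDerivWithinAt t hd
  have h3 := ((hasDerivAt_cos_two_pi (u t).1).comp_hasDerivWithinAt t h1).add
    ((hasDerivAt_cos_two_pi (u t).2).comp_hasDerivWithinAt t h2)
  have h4 : HasDerivWithinAt (fun _ : 𝕜 => (ε : ℂ) / 2) 0 s t := hasDerivWithinAt_const ..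
  have h5 := h4.congr (f₁ := (fun x : ℂ => cos (2 * Real.pi * x)) ∘ (fun τ => (u τ).1) +
    (fun x : ℂ => cos (2 * Real.pi * x)) ∘ (fun τ => (u τ).2)) (fun τ hτ => hu τ hτ) (hu t ht)
  have h6 := hs.eq_deriv s h3 h5
  have : (2 * Real.pi : ℂ) * (sin (2 * Real.pi * (u t).1) * v.1 +
      sin (2 * Real.pi * (u t).2) * v.2) = 0 := by linear_combination -h6
  exact (mul_eq_zero.1 this).resolve_left two_pi_ne_zero'

theorem differentiableOn_one_div_sin {ξ : ℂ → ℂ} {s : Set ℂ} (hξ : DifferentiableOn ℂ ξ s)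
    (h : ∀ z ∈ s, sin (2 * Real.pi * ξ z) ≠ 0) :
    DifferentiableOn ℂ (fun z => 1 / sin (2 * Real.pi * ξ z)) s :=
  (differentiableOn_const 1).div (hξ.const_mul _).csin h

theorem exists_isCurveChart {ε : ℝ} (hε : 4 < ε) (lam : ℂ) {P : ℂ × ℂ}
    (hP : P ∈ spectralCurve ε) : ∃ c pr r V ω, IsCurveChart ε lam P c pr r V ω := by
  have hb : ∀ {r : ℝ} {ξ : ℂ → ℂ} {z : ℂ}, DifferentiableOn ℂ ξ (Metric.ball 0 r) →
      z ∈ Metric.ball 0 r → HasDerivAt ξ (deriv ξ z) z := fun h hz =>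
    (h.differentiableAt (Metric.isOpen_ball.mem_nhds hz)).hasDerivAt
  rcases sin_ne_zero_or hε hP with hs | hs
  · obtain ⟨ξ, r, W, hr, hW, hPW, hξ, h1, h2⟩ := exists_graph hP hs
    have hd : ∀ z ∈ Metric.ball 0 r,
        HasDerivAt (fun z => (ξ z, P.2 + z)) (deriv ξ z, 1) z := fun z hz =>
      (hb hξ hz).prodMk ((hasDerivAt_id z).const_add P.2)
    refine ⟨fun z => (ξ z, P.2 + z), fun Q => Q.2 - P.2, r,
      {Q | Q.1 ∈ W ∧ Q.2 - P.2 ∈ Metric.ball 0 r},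
      fun z => ξ z + lam * (1 / sin (2 * Real.pi * ξ z)), hr, ?_, ?_, ?_, ?_, ?_, ?_, ?_, ?_, ?_,
      ?_, ?_, ?_⟩
    · exact (hW.preimage continuous_fst).inter
        (Metric.isOpen_ball.preimage (continuous_snd.sub continuous_const))
    · exact ⟨hPW, by simpa using hr⟩
    · exact fun z hz => (hd z hz).differentiableAt.differentiableWithinAt
    · exact fun Q => analyticAt_snd.sub analyticAt_const
    · exact fun z hz => (h1 z hz).2.2
    · exact fun z hz => ⟨(h1 z hz).2.1, by simpa using hz⟩
    · exact fun z _ => by simp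
    · exact fun Q hQ => hQ.2
    · exact fun Q hQ hQ' => Prod.ext (h2 Q hQ' hQ.1 hQ.2) (by simp)
    · simp
    · exact hξ.add ((differentiableOn_one_div_sin hξ fun z hz => (h1 z hz).1).const_mul lam)
    · intro z hz
      rw [(hd z hz).deriv, thetaForm_of_sin_ne_zero (P := (ξ z, P.2 + z)) lam (h1 z hz).1]
      simp
  -- Here x is the local coordinate, obtained from the other case by the symmetry of the equation in
  -- x and y.
  · obtain ⟨ξ, r, W, hr, hW, hPW, hξ, h1, h2⟩ := exists_graph (P := P.swap)
      (swap_mem_spectralCurve hP) hs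
    simp only [Prod.fst_swap, Prod.snd_swap] at hPW h1 h2
    have hd : ∀ z ∈ Metric.ball 0 r,
        HasDerivAt (fun z => (P.1 + z, ξ z)) (1, deriv ξ z) z := fun z hz =>
      ((hasDerivAt_id z).const_add P.1).prodMk (hb hξ hz)
    refine ⟨fun z => (P.1 + z, ξ z), fun Q => Q.1 - P.1, r,
      {Q | Q.2 ∈ W ∧ Q.1 - P.1 ∈ Metric.ball 0 r},
      fun z => (P.1 + z) * deriv ξ z - lam * (1 / sin (2 * Real.pi * ξ z)),
      hr, ?_, ?_, ?_, ?_, ?_, ?_, ?_, ?_, ?_, ?_, ?_, ?_⟩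
    · exact (hW.preimage continuous_snd).inter
        (Metric.isOpen_ball.preimage (continuous_fst.sub continuous_const))
    · exact ⟨hPW, by simpa using hr⟩
    · exact fun z hz => (hd z hz).differentiableAt.differentiableWithinAt
    · exact fun Q => analyticAt_fst.sub analyticAt_const
    · exact fun z hz => swap_mem_spectralCurve (Q := (ξ z, P.1 + z)) (h1 z hz).2.2
    · exact fun z hz => ⟨(h1 z hz).2.1, by simpa using hz⟩
    · exact fun z _ => by simp
    · exact fun Q hQ => hQ.2
    · rintro ⟨x, y⟩ hQ hQ'
      have h3 := h2 (y, x) (swap_mem_spectralCurve (Q := (x, y)) hQ') hQ.1 hQ.2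
      exact Prod.ext (add_sub_cancel P.1 x) h3
    · simp
    · exact (((differentiable_id.const_add P.1).differentiableOn).mul
        (hξ.deriv Metric.isOpen_ball)).sub
        ((differentiableOn_one_div_sin hξ fun z hz => (h1 z hz).1).const_mul lam)
    · intro z hz
      have ht := tangent_eq_zero (𝕜 := ℂ) (ε := ε) (Metric.isOpen_ball.uniqueDiffWithinAt hz) hz
        (fun τ hτ => swap_mem_spectralCurve (Q := (ξ τ, P.1 + τ)) (h1 τ hτ).2.2) (hd z hz).hasDerivWithinAt
      rw [(hd z hz).deriv, thetaForm_of_sin_snd_ne_zero (P := (P.1 + z, ξ z)) lam (h1 z hz).1 ht]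

end

/-! ### Local primitives of the form -/

noncomputable section

open Filter Set

namespace IsCurveChart

variable {ε : ℝ} {lam : ℂ} {P : ℂ × ℂ} {c : ℂ → ℂ × ℂ} {pr : ℂ × ℂ → ℂ} {r : ℝ}
  {V : Set (ℂ × ℂ)} {ω : ℂ → ℂ} (h : IsCurveChart ε lam P c pr r V ω)
include h

theorem hasDerivAt {z : ℂ} (hz : z ∈ Metric.ball 0 r) : HasDerivAt c (deriv c z) z :=
  (h.differentiableOn.differentiableAt (Metric.isOpen_ball.mem_nhds hz)).hasDerivAt

theorem hasDerivWithinAt_pr {u : ℝ → ℂ × ℂ} {v : ℂ × ℂ} {s : Set ℝ} {t : ℝ}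
    (hd : HasDerivWithinAt u v s t) :
    HasDerivWithinAt (fun τ => pr (u τ)) (fderiv ℂ pr (u t) v) s t :=
  ((h.analyticAt_pr _).differentiableAt.hasFDerivAt.restrictScalars ℝ).comp_hasDerivWithinAt t hd

/-- Near t the curve u equals c ∘ pr ∘ u, so its velocity is the image under the derivative of c of
the velocity of pr ∘ u. -/
theorem thetaForm_eq {u : ℝ → ℂ × ℂ} {v : ℂ × ℂ} {s : Set ℝ} {t : ℝ}
    (hs : UniqueDiffWithinAt ℝ s t) (ht : t ∈ s) (hu : ∀ τ ∈ s, u τ ∈ spectralCurve ε)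
    (hV : u t ∈ V) (hd : HasDerivWithinAt u v s t) :
    thetaForm lam (u t) v = ω (pr (u t)) * fderiv ℂ pr (u t) v := by
  have hp := h.hasDerivWithinAt_pr hd
  have hc : HasDerivAt c (deriv c (pr (u t))) (pr (u t)) := h.hasDerivAt (h.pr_mem _ hV)
  have h1 := hc.scomp_hasDerivWithinAt t hp
  have h2 : u =ᶠ[𝓝[s] t] c ∘ fun τ => pr (u τ) := by
    filter_upwards [hd.continuousWithinAt (h.isOpen.mem_nhds hV), self_mem_nhdsWithin]
      with τ hτ hτs
    exact (h.map_pr _ hτ (hu τ hτs)).symm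
  have h3 := h1.congr_of_eventuallyEq h2 (h.map_pr _ hV (hu t ht)).symm
  rw [hs.eq_deriv s hd h3]
  have h4 := h.form_eq _ (h.pr_mem _ hV)
  rw [h.map_pr _ hV (hu t ht)] at h4
  rw [map_smul, h4, smul_eq_mul, mul_comm, ← hs.eq_deriv s hd h3]

end IsCurveChart

/-- The form `θ_λ` is continuous along `C¹` curves. -/
theorem continuousOn_thetaForm {ε : ℝ} (hε : 4 < ε) (lam : ℂ) {u : ℝ → ℂ × ℂ} {a b : ℝ}
    (hab : a < b) (hu : ∀ τ ∈ Icc a b, u τ ∈ spectralCurve ε) (hd : ContDiffOn ℝ 1 u (Icc a b)) :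
    ContinuousOn (fun t => thetaForm lam (u t) (derivWithin u (Icc a b) t)) (Icc a b) := by
  intro t ht
  obtain ⟨c, pr, r, V, ω, h⟩ := exists_isCurveChart hε lam (hu t ht)
  have hud := uniqueDiffOn_Icc hab
  have hder : ∀ τ ∈ Icc a b, HasDerivWithinAt u (derivWithin u (Icc a b) τ) (Icc a b) τ :=
    fun τ hτ => (hd.differentiableOn one_ne_zero τ hτ).hasDerivWithinAt
  have hev : ∀ᶠ τ in 𝓝[Icc a b] t, u τ ∈ V :=
    (hd.continuousOn t ht) (h.isOpen.mem_nhds h.mem)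
  have hcont : ContinuousWithinAt
      (fun τ => ω (pr (u τ)) * fderiv ℂ pr (u τ) (derivWithin u (Icc a b) τ)) (Icc a b) t := by
    have h1 : ContinuousAt ω (pr (u t)) :=
      (h.differentiableOn_form.differentiableAt
        (Metric.isOpen_ball.mem_nhds (h.pr_mem _ h.mem))).continuousAt
    have h2 : ContinuousAt (fun Q => ω (pr Q)) (u t) := h1.comp (h.analyticAt_pr _).continuousAt
    have h3 : ContinuousAt (fderiv ℂ pr) (u t) := (h.analyticAt_pr _).fderiv.continuousAt
    have h4 := hd.continuousOn t ht
    have h5 := hd.continuousOn_derivWithin hud le_rfl t ht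
    exact (h2.comp_continuousWithinAt h4).mul
      ((h3.comp_continuousWithinAt h4).clm_apply h5)
  refine hcont.congr_of_eventuallyEq ?_ (h.thetaForm_eq (hud t ht) ht hu h.mem (hder t ht))
  filter_upwards [hev, self_mem_nhdsWithin] with τ hτ hτs
  exact h.thetaForm_eq (hud τ hτs) hτs hu hτ (hder τ hτs)

/-- `F` is a primitive of `θ_λ` on the part of the spectral curve in `U`. -/
def IsThetaPrimitiveOn (ε : ℝ) (lam : ℂ) (F : ℂ × ℂ → ℂ) (U : Set (ℂ × ℂ)) : Prop :=
  ∀ (a b : ℝ) (u : ℝ → ℂ × ℂ) (v : ℂ × ℂ) (t : ℝ), a < b → t ∈ Icc a b →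
    (∀ τ ∈ Icc a b, u τ ∈ spectralCurve ε) → u t ∈ U → HasDerivWithinAt u v (Icc a b) t →
    HasDerivWithinAt (fun τ => F (u τ)) (thetaForm lam (u t) v) (Icc a b) t

/-- The holomorphic coefficient ω has a primitive on the disc; compose it with the coordinate `pr`.
-/
theorem IsCurveChart.exists_primitive {ε : ℝ} {lam : ℂ} {P : ℂ × ℂ} {c : ℂ → ℂ × ℂ}
    {pr : ℂ × ℂ → ℂ} {r : ℝ} {V : Set (ℂ × ℂ)} {ω : ℂ → ℂ}
    (h : IsCurveChart ε lam P c pr r V ω) :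
    ∃ F, AnalyticAt ℂ F P ∧ IsThetaPrimitiveOn ε lam F V := by
  obtain ⟨Ψ, hΨ⟩ := h.differentiableOn_form.isExactOn_ball
  refine ⟨fun Q => Ψ (pr Q), ?_, ?_⟩
  · have h1 : AnalyticAt ℂ Ψ (pr P) := by
      refine DifferentiableOn.analyticAt (s := Metric.ball 0 r) (fun z hz =>
        (hΨ z hz).differentiableAt.differentiableWithinAt)
        (Metric.isOpen_ball.mem_nhds (h.pr_mem _ h.mem))
    exact h1.comp (h.analyticAt_pr P)
  · intro a b u v t hab ht hu hV hd
    rw [h.thetaForm_eq (uniqueDiffOn_Icc hab t ht) ht hu hV hd]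
    exact (hΨ _ (h.pr_mem _ hV)).comp_hasDerivWithinAt t (h.hasDerivWithinAt_pr hd)

/-- Primitives are tested only along curves, so P is joined to a nearby Q by the chart image of a
segment, along which the difference has zero derivative. -/
theorem IsThetaPrimitiveOn.eventually_sub_eq {ε : ℝ} (hε : 4 < ε) {lam : ℂ}
    {F F' : ℂ × ℂ → ℂ} {U U' : Set (ℂ × ℂ)} (hF : IsThetaPrimitiveOn ε lam F U)
    (hF' : IsThetaPrimitiveOn ε lam F' U') (hU : IsOpen U) (hU' : IsOpen U') {P : ℂ × ℂ}
    (hP : P ∈ spectralCurve ε) (hPU : P ∈ U) (hPU' : P ∈ U') :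
    ∀ᶠ Q in 𝓝 P, Q ∈ spectralCurve ε → F Q - F' Q = F P - F' P := by
  obtain ⟨c, pr, r, V, ω, h⟩ := exists_isCurveChart hε lam hP
  have h0 : (0 : ℂ) ∈ Metric.ball (0 : ℂ) r := by simpa using h.pos
  have hc0 : c 0 = P := by rw [← h.pr_self]; exact h.map_pr _ h.mem hP
  have hcc : ContinuousAt c 0 := (h.hasDerivAt h0).continuousAt
  have hmem : ∀ᶠ z in 𝓝 (0 : ℂ), z ∈ Metric.ball (0 : ℂ) r ∧ c z ∈ U ∧ c z ∈ U' := by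
    refine (show ∀ᶠ z in 𝓝 (0 : ℂ), z ∈ Metric.ball (0 : ℂ) r from
      Metric.isOpen_ball.mem_nhds h0).and
      ((hcc.eventually (p := (· ∈ U)) ?_).and (hcc.eventually (p := (· ∈ U')) ?_))
    · rw [hc0]; exact hU.mem_nhds hPU
    · rw [hc0]; exact hU'.mem_nhds hPU'
  obtain ⟨s, hs, hball⟩ := Metric.eventually_nhds_iff_ball.1 hmem
  have hpr : ∀ᶠ Q in 𝓝 P, pr Q ∈ Metric.ball (0 : ℂ) s := by
    refine (h.analyticAt_pr P).continuousAt.eventually (p := (· ∈ Metric.ball (0 : ℂ) s)) ?_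
    rw [h.pr_self]
    exact Metric.ball_mem_nhds _ hs
  filter_upwards [hpr, h.isOpen.mem_nhds h.mem] with Q hQs hQV hQ
  have hz : ∀ τ ∈ Icc (0 : ℝ) 1, (τ : ℂ) * pr Q ∈ Metric.ball (0 : ℂ) s := by
    intro τ hτ
    rw [mem_ball_zero_iff] at *
    rw [norm_mul, norm_real, Real.norm_of_nonneg hτ.1]
    exact (mul_le_of_le_one_left (norm_nonneg _) hτ.2).trans_lt hQs
  set u : ℝ → ℂ × ℂ := fun τ => c (τ * pr Q) with hu
  have hud : ∀ τ ∈ Icc (0 : ℝ) 1, HasDerivWithinAt u (pr Q • deriv c (τ * pr Q)) (Icc 0 1) τ := by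
    intro τ hτ
    have h1 : HasDerivWithinAt (fun τ : ℝ => (τ : ℂ) * pr Q) (pr Q) (Icc 0 1) τ := by
      simpa using ((hasDerivAt_id τ).ofReal_comp.mul_const (pr Q)).hasDerivWithinAt
    exact (h.hasDerivAt (hball _ (hz τ hτ)).1).scomp_hasDerivWithinAt τ h1
  have humem : ∀ τ ∈ Icc (0 : ℝ) 1, u τ ∈ spectralCurve ε := fun τ hτ =>
    h.map_mem _ (hball _ (hz τ hτ)).1
  have hdiff : ∀ τ ∈ Icc (0 : ℝ) 1,
      HasDerivWithinAt (fun τ => F (u τ) - F' (u τ)) 0 (Icc 0 1) τ := by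
    intro τ hτ
    have h1 := hF 0 1 u _ τ one_pos hτ humem (hball _ (hz τ hτ)).2.1 (hud τ hτ)
    have h2 := hF' 0 1 u _ τ one_pos hτ humem (hball _ (hz τ hτ)).2.2 (hud τ hτ)
    rw [← sub_self (thetaForm lam (u τ) (pr Q • deriv c (τ * pr Q)))]
    exact h1.sub h2
  have := constant_of_derivWithin_zero (fun τ hτ => (hdiff τ hτ).differentiableWithinAt)
    (fun τ hτ => (hdiff τ (Ico_subset_Icc_self hτ)).derivWithin
      (uniqueDiffOn_Icc one_pos τ (Ico_subset_Icc_self hτ))) 1 (right_mem_Icc.2 zero_le_one)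
  have e1 : u 1 = Q := by simp [hu, h.map_pr Q hQV hQ]
  have e0 : u 0 = P := by simp [hu, hc0]
  rwa [e1, e0] at this

/-- The local primitives of `θ_λ` on the spectral curve. -/
def thetaSystem {ε : ℝ} (hε : 4 < ε) (lam : ℂ) : PrimitiveSystem (spectralCurve ε) where
  IsPrim P f := ∃ (F : ℂ × ℂ → ℂ) (U : Set (ℂ × ℂ)), IsOpen U ∧ (P : ℂ × ℂ) ∈ U ∧
    IsThetaPrimitiveOn ε lam F U ∧ ∀ Q : spectralCurve ε, f Q = F Q
  exists_isPrim P := by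
    obtain ⟨c, pr, r, V, ω, h⟩ := exists_isCurveChart hε lam P.2
    obtain ⟨F, -, hF⟩ := h.exists_primitive
    exact ⟨fun Q => F Q, F, V, h.isOpen, h.mem, hF, fun _ => rfl⟩
  eventually_isPrim := by
    rintro P f ⟨F, U, hU, hPU, hF, hf⟩
    filter_upwards [continuous_subtype_val.continuousAt (hU.mem_nhds hPU)] with Q hQ
    exact ⟨F, U, hU, hQ, hF, hf⟩
  eventually_sub_eq := by
    rintro P f f' ⟨F, U, hU, hPU, hF, hf⟩ ⟨F', U', hU', hPU', hF', hf'⟩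
    filter_upwards [continuous_subtype_val.continuousAt
      (hF.eventually_sub_eq hε hF' hU hU' P.2 hPU hPU')] with Q hQ
    rw [hf, hf, hf', hf']
    exact hQ Q.2

end

/-! ### Periods as curve integrals -/

noncomputable section

open Filter Set unitInterval

section PeriodIntegral

variable {ε : ℝ} {P Q : spectralCurve ε}

theorem toAmbient_extend (γ : Path P Q) (t : ℝ) :
    (toAmbient γ).extend t = (γ (projIcc 0 1 zero_le_one t) : ℂ × ℂ) := rfl

theorem toAmbient_extend_mem (γ : Path P Q) (t : ℝ) :
    (toAmbient γ).extend t ∈ spectralCurve ε := (γ (projIcc 0 1 zero_le_one t)).2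

theorem hasDerivWithinAt_of_isPrimAlong (hε : 4 < ε) (lam : ℂ) (γ : Path P Q) {G : I → ℂ}
    (hG : (thetaSystem hε lam).IsPrimAlong γ G) {a b : ℝ} (hab : a < b)
    (hd : ContDiffOn ℝ 1 (toAmbient γ).extend (Icc a b)) {t : ℝ} (ht : t ∈ Icc a b) :
    HasDerivWithinAt (fun t => G (projIcc 0 1 zero_le_one t))
      (thetaForm lam ((toAmbient γ).extend t) (derivWithin (toAmbient γ).extend (Icc a b) t))
      (Icc a b) t := by
  obtain ⟨f, ⟨F, U, hU, hmem, hF, hf⟩, hG'⟩ := hG (projIcc 0 1 zero_le_one t)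
  have h1 := hF a b (toAmbient γ).extend _ t hab ht (fun τ _ => toAmbient_extend_mem γ τ) hmem
    (hd.differentiableOn one_ne_zero t ht).hasDerivWithinAt
  have h2 := (continuous_projIcc (h := zero_le_one' ℝ)).continuousAt.eventually hG'
  have h3 := h1.add_const (G (projIcc 0 1 zero_le_one t) - F ((toAmbient γ).extend t))
  refine h3.congr_of_eventuallyEq ?_ (by ring)
  filter_upwards [nhdsWithin_le_nhds h2] with τ hτ
  rw [hf, hf] at hτ
  rw [toAmbient_extend, toAmbient_extend]
  linear_combination hτ

theorem curveIntegral_eq_period (hε : 4 < ε) (lam : ℂ) (γ : Path P Q)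
    (hγ : IsPiecewiseC1 (toAmbient γ)) :
    curveIntegral (thetaForm lam) (toAmbient γ) = (thetaSystem hε lam).period γ := by
  obtain ⟨G, hG⟩ := (thetaSystem hε lam).exists_isPrimAlong γ
  obtain ⟨n, t, ht, h0, h1, hd⟩ := hγ
  set u := (toAmbient γ).extend with hu
  have key : ∀ i < n,
      IntervalIntegrable (curveIntegralFun (thetaForm lam) (toAmbient γ)) MeasureTheory.volume
        (t i) (t (i + 1)) ∧
      ∫ τ in t i..t (i + 1), curveIntegralFun (thetaForm lam) (toAmbient γ) τ =
        G (projIcc 0 1 zero_le_one (t (i + 1))) - G (projIcc 0 1 zero_le_one (t i)) := by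
    intro i hi
    -- The subdivision is only weakly monotone, so pieces of length zero occur.
    rcases (ht i.le_succ).eq_or_lt with he | hlt
    · simp only [Nat.succ_eq_add_one] at he
      rw [← he]; simp
    simp only [Nat.succ_eq_add_one] at hlt
    have ha : 0 ≤ t i := h0 ▸ ht i.zero_le
    have hb : t (i + 1) ≤ 1 := h1 ▸ ht hi
    have hcont := continuousOn_thetaForm hε lam hlt
      (fun τ _ => toAmbient_extend_mem γ τ) (hd i hi)
    -- The integrand uses the derivative within [0, 1], which may differ from the one within the
    -- piece at break points; these form a null set.
    have heq : ∀ τ ∈ Ioo (t i) (t (i + 1)), curveIntegralFun (thetaForm lam) (toAmbient γ) τ =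
        thetaForm lam (u τ) (derivWithin u (Icc (t i) (t (i + 1))) τ) := by
      intro τ hτ
      rw [curveIntegralFun_def, derivWithin_of_mem_nhds (Icc_mem_nhds hτ.1 hτ.2),
        derivWithin_of_mem_nhds (Icc_mem_nhds (ha.trans_lt hτ.1) (hτ.2.trans_le hb))]
    have hae : (fun τ => thetaForm lam (u τ) (derivWithin u (Icc (t i) (t (i + 1))) τ))
        =ᵐ[MeasureTheory.volume.restrict (Set.uIoc (t i) (t (i + 1)))]
        curveIntegralFun (thetaForm lam) (toAmbient γ) := by
      rw [uIoc_of_le hlt.le, ← MeasureTheory.restrict_Ioo_eq_restrict_Ioc]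
      filter_upwards [MeasureTheory.ae_restrict_mem measurableSet_Ioo] with τ hτ
      exact (heq τ hτ).symm
    have hint : IntervalIntegrable
        (fun τ => thetaForm lam (u τ) (derivWithin u (Icc (t i) (t (i + 1))) τ))
        MeasureTheory.volume (t i) (t (i + 1)) :=
      hcont.intervalIntegrable_of_Icc hlt.le
    have hder : ∀ τ ∈ Icc (t i) (t (i + 1)), _ := fun τ hτ =>
      hasDerivWithinAt_of_isPrimAlong hε lam γ hG hlt (hd i hi) hτ
    refine ⟨hint.congr_ae hae, ?_⟩
    rw [← intervalIntegral.integral_congr_ae_restrict hae]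
    exact intervalIntegral.integral_eq_sub_of_hasDerivAt_of_le hlt.le
      (fun τ hτ => (hder τ hτ).continuousWithinAt)
      (fun τ hτ => (hder τ (Ioo_subset_Icc_self hτ)).hasDerivAt (Icc_mem_nhds hτ.1 hτ.2)) hint
  have hsum := intervalIntegral.sum_integral_adjacent_intervals fun i hi => (key i hi).1
  rw [curveIntegral_def, hG.period_eq, ← h0, ← h1, ← hsum,
    Finset.sum_congr rfl fun i hi => (key i (Finset.mem_range.1 hi)).2,
    Finset.sum_range_sub (fun i => G (projIcc 0 1 zero_le_one (t i))), h0, h1,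
    projIcc_right, projIcc_left]
  rfl

end PeriodIntegral

section PiecewiseC1

theorem IsPiecewiseC1.trans {a b c : ℂ × ℂ} {γ : Path a b} {γ' : Path b c}
    (h : IsPiecewiseC1 γ) (h' : IsPiecewiseC1 γ') : IsPiecewiseC1 (γ.trans γ') := by
  obtain ⟨n, t, ht, h0, h1, hd⟩ := h
  obtain ⟨m, s, hs, k0, k1, kd⟩ := h'
  -- At the junction index n both formulas give 1/2, so the second may be used from n on.
  have hT : ∀ i, n ≤ i → (if i ≤ n then t i / 2 else (1 + s (i - n)) / 2) =
      (1 + s (i - n)) / 2 := by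
    intro i hi
    split_ifs with hin
    · rw [le_antisymm hin hi]; simp [h1, k0]
    · rfl
  refine ⟨n + m, fun i => if i ≤ n then t i / 2 else (1 + s (i - n)) / 2, ?_, ?_, ?_, ?_⟩
  · refine monotone_nat_of_le_succ fun i => ?_
    rcases lt_or_ge i n with hi | hi
    · rw [if_pos hi.le, if_pos (Nat.succ_le_of_lt hi)]
      linarith [ht i.le_succ]
    · rw [hT i hi, hT (i + 1) (by omega)]
      linarith [hs (show i - n ≤ i + 1 - n by omega)]
  · simp [h0]
  · dsimp only
    rw [hT _ (by omega)]
    simp [k1]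
  · intro i hi
    dsimp only
    rcases lt_or_ge i n with hin | hin
    · rw [if_pos hin.le, if_pos (Nat.succ_le_of_lt hin)]
      have hmaps : MapsTo (fun τ : ℝ => 2 * τ) (Icc (t i / 2) (t (i + 1) / 2))
          (Icc (t i) (t (i + 1))) := fun τ hτ => ⟨by linarith [hτ.1], by linarith [hτ.2]⟩
      refine ((hd i hin).comp (contDiff_const.mul contDiff_id).contDiffOn hmaps).congr ?_
      intro τ hτ
      have hle : t (i + 1) ≤ 1 := h1 ▸ ht hin
      exact Path.extend_trans_of_le_half _ _ (by linarith [hτ.2])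
    · rw [hT i hin, hT (i + 1) (by omega)]
      have e : i + 1 - n = (i - n) + 1 := by omega
      rw [e]
      have hmaps : MapsTo (fun τ : ℝ => 2 * τ - 1)
          (Icc ((1 + s (i - n)) / 2) ((1 + s (i - n + 1)) / 2))
          (Icc (s (i - n)) (s (i - n + 1))) := fun τ hτ =>
        ⟨by linarith [hτ.1], by linarith [hτ.2]⟩
      refine ((kd (i - n) (by omega)).comp
        ((contDiff_const.mul contDiff_id).sub contDiff_const).contDiffOn hmaps).congr ?_
      intro τ hτ
      have hle : 0 ≤ s (i - n) := k0 ▸ hs (Nat.zero_le _)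
      exact Path.extend_trans_of_half_le _ _ (by linarith [hτ.1])

end PiecewiseC1
end

/-! ### Piecewise C¹ representatives of homotopy classes -/

noncomputable section

open Filter Set unitInterval

theorem isPiecewiseC1_of_contDiffOn {a b : ℂ × ℂ} {γ : Path a b}
    (h : ContDiffOn ℝ 1 γ.extend (Icc 0 1)) : IsPiecewiseC1 γ := by
  refine ⟨1, fun n => if n = 0 then 0 else 1, ?_, by simp, by simp, ?_⟩
  · refine monotone_nat_of_le_succ fun n => ?_
    rcases n with _ | n <;> simp
  · intro i hi
    obtain rfl : i = 0 := by omega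
    simpa using h

/-- The path is homotopic to a piecewise `C¹` path. -/
def HasC1Representative {ε : ℝ} {P Q : spectralCurve ε} (γ : Path P Q) : Prop :=
  ∃ γ' : Path P Q, γ'.Homotopic γ ∧ IsPiecewiseC1 (toAmbient γ')

namespace HasC1Representative

variable {ε : ℝ} {P Q R : spectralCurve ε}

theorem of_homotopic {γ γ' : Path P Q} (h : HasC1Representative γ) (hγ : γ.Homotopic γ') :
    HasC1Representative γ' := by
  obtain ⟨δ, hδ, hc⟩ := h
  exact ⟨δ, hδ.trans hγ, hc⟩

theorem trans {γ : Path P Q} {γ' : Path Q R} (h : HasC1Representative γ)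
    (h' : HasC1Representative γ') : HasC1Representative (γ.trans γ') := by
  obtain ⟨δ, hδ, hc⟩ := h
  obtain ⟨δ', hδ', hc'⟩ := h'
  refine ⟨δ.trans δ', hδ.hcomp hδ', ?_⟩
  rw [toAmbient, Path.map_trans]
  exact hc.trans hc'

theorem of_cast {P' Q' : spectralCurve ε} {γ : Path P Q} {hP : P' = P} {hQ : Q' = Q}
    (h : HasC1Representative (γ.cast hP hQ)) : HasC1Representative γ := by
  subst hP hQ
  exact h

end HasC1Representative

theorem homotopic_cast {X : Type*} [TopologicalSpace X] {x y x' y' : X} {γ γ' : Path x y}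
    (h : γ.Homotopic γ') (hx : x' = x) (hy : y' = y) :
    (γ.cast hx hy).Homotopic (γ'.cast hx hy) := by
  subst hx hy
  exact h

section Chart

variable {ε : ℝ} {lam : ℂ} {P : ℂ × ℂ} {c : ℂ → ℂ × ℂ} {pr : ℂ × ℂ → ℂ} {r : ℝ}
  {V : Set (ℂ × ℂ)} {ω : ℂ → ℂ}

/-- In the disc of the chart, which is convex and hence simply connected, the path is homotopic to a
segment; the chart carries this homotopy to the curve. -/
theorem IsCurveChart.hasC1Representative (h : IsCurveChart ε lam P c pr r V ω)
    {Q R : spectralCurve ε} (γ : Path Q R) (hγ : ∀ t, (γ t : ℂ × ℂ) ∈ V) :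
    HasC1Representative γ := by
  let C : Metric.ball (0 : ℂ) r → spectralCurve ε := fun z => ⟨c z, h.map_mem z z.2⟩
  have hC : Continuous C :=
    (continuousOn_iff_continuous_domRestrict.1 h.differentiableOn.continuousOn).subtype_mk _
  have hCpr : ∀ S : spectralCurve ε, ∀ hS : (S : ℂ × ℂ) ∈ V, C ⟨pr S, h.pr_mem _ hS⟩ = S :=
    fun S hS => Subtype.ext (h.map_pr S hS S.2)
  have hQ : (Q : ℂ × ℂ) ∈ V := by simpa using hγ 0
  have hR : (R : ℂ × ℂ) ∈ V := by simpa using hγ 1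
  have hprc : Continuous pr := continuous_iff_continuousAt.2 fun S => (h.analyticAt_pr S).continuousAt
  let z : Metric.ball (0 : ℂ) r := ⟨pr Q, h.pr_mem _ hQ⟩
  let w : Metric.ball (0 : ℂ) r := ⟨pr R, h.pr_mem _ hR⟩
  have hconv : Convex ℝ (Metric.ball (0 : ℂ) r) := convex_ball 0 r
  have hseg : ∀ t ∈ Icc (0 : ℝ) 1, AffineMap.lineMap (z : ℂ) (w : ℂ) t ∈ Metric.ball (0 : ℂ) r :=
    fun t ht => hconv.lineMap_mem z.2 w.2 ht
  let α : Path z w :=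
    { toFun := fun t => ⟨pr (γ t), h.pr_mem _ (hγ t)⟩
      continuous_toFun :=
        (hprc.comp (continuous_subtype_val.comp γ.continuous)).subtype_mk _
      source' := Subtype.ext (by simp [z])
      target' := Subtype.ext (by simp [w]) }
  let β : Path z w :=
    { toFun := fun t => ⟨AffineMap.lineMap (z : ℂ) (w : ℂ) (t : ℝ), hseg t t.2⟩
      continuous_toFun :=
        (AffineMap.lineMap_continuous.comp continuous_subtype_val).subtype_mk _
      source' := Subtype.ext (by simp)
      target' := Subtype.ext (by simp) }
  have : ContractibleSpace (Metric.ball (0 : ℂ) r) := hconv.contractibleSpace ⟨z, z.2⟩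
  have hom : β.Homotopic α := SimplyConnectedSpace.paths_homotopic β α
  have hom2 : ((β.map hC).cast (hCpr Q hQ).symm (hCpr R hR).symm).Homotopic γ := by
    have e : (α.map hC).cast (hCpr Q hQ).symm (hCpr R hR).symm = γ := by
      ext1; funext t; exact hCpr _ (hγ t)
    rw [← e]
    exact homotopic_cast (hom.map ⟨C, hC⟩) _ _
  refine ⟨_, hom2, isPiecewiseC1_of_contDiffOn ?_⟩
  have h1 : ContDiffOn ℝ 1 c (Metric.ball 0 r) :=
    (h.differentiableOn.contDiffOn Metric.isOpen_ball).restrict_scalars ℝ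
  have h2 : ContDiff ℝ 1 (fun t : ℝ => AffineMap.lineMap (z : ℂ) (w : ℂ) t) := by
    simp only [AffineMap.lineMap_apply_module]
    fun_prop
  refine (h1.comp h2.contDiffOn hseg).congr fun t ht => ?_
  rw [Path.extend_apply _ ht]
  rfl

theorem hasC1Representative (hε : 4 < ε) {Q R : spectralCurve ε} (γ : Path Q R) :
    HasC1Representative γ := by
  -- Only the geometry of the charts matters here, so the parameter of the form is set to 0.
  choose c pr r V ω h using fun S : spectralCurve ε => exists_isCurveChart hε 0 S.2
  obtain ⟨t, t0, tmono, ⟨n, hn⟩, hsub⟩ := exists_monotone_Icc_subset_open_cover_unitInterval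
    (c := fun S : spectralCurve ε => {τ : I | (γ τ : ℂ × ℂ) ∈ V S})
    (fun S => (h S).isOpen.preimage (continuous_subtype_val.comp γ.continuous))
    (fun τ _ => mem_iUnion.2 ⟨γ τ, (h (γ τ)).mem⟩)
  have key : ∀ k, HasC1Representative (γ.subpath 0 (t k)) := by
    intro k
    induction k with
    | zero =>
      rw [t0]
      refine ⟨_, .refl _, isPiecewiseC1_of_contDiffOn ?_⟩
      rw [Path.subpath_self]
      exact contDiffOn_const (c := ((γ 0 : spectralCurve ε) : ℂ × ℂ))
    | succ k ih =>
      obtain ⟨S, hS⟩ := hsub k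
      have h2 : HasC1Representative (γ.subpath (t k) (t (k + 1))) := by
        refine (h S).hasC1Representative _ fun τ => ?_
        have : γ.subpath (t k) (t (k + 1)) τ ∈ range (γ.subpath (t k) (t (k + 1))) := ⟨τ, rfl⟩
        rw [Path.range_subpath_of_le _ _ _ (tmono k.le_succ)] at this
        obtain ⟨τ', hτ', e⟩ := this
        rw [← e]
        exact hS hτ'
      exact (ih.trans h2).of_homotopic ⟨Path.Homotopy.subpathTransSubpath γ 0 (t k) (t (k + 1))⟩
  have := key n
  rw [hn n le_rfl, Path.subpath_zero_one] at this
  exact this.of_cast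

end Chart

end

/-! ### The exponential period and the symmetries of the form -/

noncomputable section

open Filter Set

/-- A piecewise C¹ representative exists and all of them give the same value, so the default 0 never
occurs; γ itself need only be continuous. -/
theorem expPeriod_eq {ε : ℝ} (hε : 4 < ε) (lam : ℂ) {P₀ : spectralCurve ε}
    (z : UniversalCover P₀) (γ : Path P₀ z.1) (hγ : Path.Homotopic.Quotient.mk γ = z.2) :
    expPeriod lam z = exp (2 * Real.pi * I * (thetaSystem hε lam).period γ) := by
  have huniq : ∀ w, IsExpPeriod lam z w →
      w = exp (2 * Real.pi * I * (thetaSystem hε lam).period γ) := by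
    rintro w ⟨δ, hδ, hc, rfl⟩
    have hom : δ.Homotopic γ := Path.Homotopic.Quotient.exact (hδ.trans hγ.symm)
    rw [curveIntegral_eq_period hε lam δ hc, PrimitiveSystem.period_eq_of_homotopic hom]
  have hex : ∃! w, IsExpPeriod lam z w := by
    obtain ⟨δ, hδ, hc⟩ := hasC1Representative hε γ
    have h1 : IsExpPeriod lam z _ := ⟨δ, (Path.Homotopic.Quotient.eq.2 hδ).trans hγ, hc, rfl⟩
    exact ⟨_, h1, fun w hw => (huniq w hw).trans (huniq _ h1).symm⟩
  rw [expPeriod, dif_pos hex]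
  exact huniq _ hex.choose_spec.1

theorem IsCurveChart.exists_path {ε : ℝ} {lam : ℂ} {P : ℂ × ℂ} {c : ℂ → ℂ × ℂ}
    {pr : ℂ × ℂ → ℂ} {r : ℝ} {V : Set (ℂ × ℂ)} {ω : ℂ → ℂ}
    (h : IsCurveChart ε lam P c pr r V ω) {Q R : spectralCurve ε} (hQ : (Q : ℂ × ℂ) ∈ V)
    (hR : (R : ℂ × ℂ) ∈ V) : ∃ γ : Path Q R, ∀ t, (γ t : ℂ × ℂ) ∈ V := by
  let C : Metric.ball (0 : ℂ) r → spectralCurve ε := fun z => ⟨c z, h.map_mem z z.2⟩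
  have hC : Continuous C :=
    (continuousOn_iff_continuous_domRestrict.1 h.differentiableOn.continuousOn).subtype_mk _
  have hCpr : ∀ S : spectralCurve ε, ∀ hS : (S : ℂ × ℂ) ∈ V, C ⟨pr S, h.pr_mem _ hS⟩ = S :=
    fun S hS => Subtype.ext (h.map_pr S hS S.2)
  have : ContractibleSpace (Metric.ball (0 : ℂ) r) :=
    (convex_ball (0 : ℂ) r).contractibleSpace ⟨_, h.pr_mem _ hQ⟩
  obtain ⟨α⟩ := PathConnectedSpace.joined (⟨pr Q, h.pr_mem _ hQ⟩ : Metric.ball (0 : ℂ) r)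
    ⟨pr R, h.pr_mem _ hR⟩
  exact ⟨(α.map hC).cast (hCpr Q hQ).symm (hCpr R hR).symm, fun t => h.map_mem_dom _ (α t).2⟩

section Symmetry

variable {ε : ℝ}

/-- The involution `(x, y) ↦ (y, x)` of the spectral curve. -/
def swapCurve (P : spectralCurve ε) : spectralCurve ε :=
  ⟨(P : ℂ × ℂ).swap, swap_mem_spectralCurve P.2⟩

theorem continuous_swapCurve : Continuous (swapCurve (ε := ε)) :=
  (continuous_swap.comp continuous_subtype_val).subtype_mk _

theorem continuous_shiftX : Continuous (shiftX (ε := ε)) := by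
  unfold shiftX
  fun_prop

theorem continuous_shiftY : Continuous (shiftY (ε := ε)) := by
  unfold shiftY
  fun_prop

theorem sin_two_pi_add_one (x : ℂ) : sin (2 * Real.pi * (x + 1)) = sin (2 * Real.pi * x) := by
  rw [mul_add, mul_one, sin_add_two_pi]

theorem thetaForm_shiftX (lam : ℂ) (P v : ℂ × ℂ) :
    thetaForm lam (P.1 + 1, P.2) v = thetaForm lam P v + v.2 := by
  have : omegaForm (P.1 + 1, P.2) = omegaForm P := by
    simp only [omegaForm, sin_two_pi_add_one]
  simp only [thetaForm, this, add_apply, smul_apply,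
    ContinuousLinearMap.coe_snd', smul_eq_mul]
  ring

theorem thetaForm_shiftY (lam : ℂ) (P v : ℂ × ℂ) :
    thetaForm lam (P.1, P.2 + 1) v = thetaForm lam P v := by
  have : omegaForm (P.1, P.2 + 1) = omegaForm P := by
    simp only [omegaForm, sin_two_pi_add_one]
  simp only [thetaForm, this]

/-- On tangent vectors the swap changes the sign of dy / sin 2πx, so the λ-terms cancel and x dy + y
dx remains. -/
theorem thetaForm_swap (hε : 4 < ε) (lam : ℂ) {P v : ℂ × ℂ} (hP : P ∈ spectralCurve ε)
    (hv : sin (2 * Real.pi * P.1) * v.1 + sin (2 * Real.pi * P.2) * v.2 = 0) :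
    thetaForm lam P v = P.1 * v.2 + P.2 * v.1 - thetaForm lam P.swap v.swap := by
  rcases sin_ne_zero_or hε hP with hs | hs
  · rw [thetaForm_of_sin_ne_zero lam hs, thetaForm_of_sin_snd_ne_zero (P := P.swap) lam hs
      (by rw [← hv]; exact add_comm _ _)]
    simp only [Prod.fst_swap, Prod.snd_swap]
    ring
  · rw [thetaForm_of_sin_snd_ne_zero lam hs hv, thetaForm_of_sin_ne_zero (P := P.swap) lam hs]
    simp only [Prod.fst_swap, Prod.snd_swap]
    ring

variable (hε : 4 < ε) (lam : ℂ) {P Q : spectralCurve ε}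

theorem period_map_shiftX (γ : Path P Q) :
    (thetaSystem hε lam).period γ = (thetaSystem hε lam).period (γ.map continuous_shiftX)
      - Q.1.2 + P.1.2 := by
  rw [PrimitiveSystem.period_eq_of_map continuous_shiftX (c := 1) (h := fun P => -P.1.2) ?_ γ]
  · ring
  rintro P f ⟨F, U, hU, hPU, hF, hf⟩
  refine ⟨fun Q => 1 * F (Q.1 + 1, Q.2) + -Q.2, (fun Q => (Q.1 + 1, Q.2)) ⁻¹' U,
    hU.preimage (by fun_prop), hPU, ?_, fun Q => by dsimp only; rw [hf]; rfl⟩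
  intro a b u v t hab ht hu hut hd
  have hd2 : HasDerivWithinAt (fun τ => (u τ).2) v.2 (Icc a b) t :=
    (ContinuousLinearMap.snd ℝ ℂ ℂ).hasFDerivAt.comp_hasDerivWithinAt t hd
  have hd1 : HasDerivWithinAt (fun τ => (u τ).1) v.1 (Icc a b) t :=
    (ContinuousLinearMap.fst ℝ ℂ ℂ).hasFDerivAt.comp_hasDerivWithinAt t hd
  have hd' : HasDerivWithinAt (fun τ => ((u τ).1 + 1, (u τ).2)) (v.1, v.2) (Icc a b) t :=
    (hd1.add_const (1 : ℂ)).prodMk hd2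
  have h1 := hF a b (fun τ => ((u τ).1 + 1, (u τ).2)) (v.1, v.2) t hab ht
    (fun τ hτ => (shiftX ⟨u τ, hu τ hτ⟩).2) hut hd'
  rw [thetaForm_shiftX] at h1
  have h2 := (h1.const_mul (1 : ℂ)).add hd2.neg
  rw [one_mul, add_neg_cancel_right] at h2
  exact h2

theorem period_map_shiftY (γ : Path P Q) :
    (thetaSystem hε lam).period γ = (thetaSystem hε lam).period (γ.map continuous_shiftY) := by
  rw [PrimitiveSystem.period_eq_of_map continuous_shiftY (c := 1) (h := fun _ => 0) ?_ γ]
  · ring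
  rintro P f ⟨F, U, hU, hPU, hF, hf⟩
  refine ⟨fun Q => 1 * F (Q.1, Q.2 + 1) + 0, (fun Q => (Q.1, Q.2 + 1)) ⁻¹' U,
    hU.preimage (by fun_prop), hPU, ?_, fun Q => by dsimp only; rw [hf]; rfl⟩
  intro a b u v t hab ht hu hut hd
  have hd' : HasDerivWithinAt (fun τ => ((u τ).1, (u τ).2 + 1)) v (Icc a b) t :=
    ((ContinuousLinearMap.fst ℝ ℂ ℂ).hasFDerivAt.comp_hasDerivWithinAt t hd).prodMk
    (((ContinuousLinearMap.snd ℝ ℂ ℂ).hasFDerivAt.comp_hasDerivWithinAt t hd).add_const 1)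
  have h1 := hF a b _ v t hab ht (fun τ hτ => (shiftY ⟨u τ, hu τ hτ⟩).2) hut hd'
  rw [thetaForm_shiftY] at h1
  convert! (h1.const_mul 1).add_const (0 : ℂ) using 1
  ring

theorem period_map_swapCurve (γ : Path P Q) :
    (thetaSystem hε lam).period γ = Q.1.1 * Q.1.2 - P.1.1 * P.1.2
      - (thetaSystem hε lam).period (γ.map continuous_swapCurve) := by
  rw [PrimitiveSystem.period_eq_of_map continuous_swapCurve (c := -1)
    (h := fun P => P.1.1 * P.1.2) ?_ γ]
  · ring
  rintro P f ⟨F, U, hU, hPU, hF, hf⟩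
  refine ⟨fun Q => -1 * F Q.swap + Q.1 * Q.2, Prod.swap ⁻¹' U,
    hU.preimage continuous_swap, hPU, ?_, fun Q => by dsimp only; rw [hf]; rfl⟩
  intro a b u v t hab ht hu hut hd
  have hd1 : HasDerivWithinAt (fun τ => (u τ).1) v.1 (Icc a b) t :=
    (ContinuousLinearMap.fst ℝ ℂ ℂ).hasFDerivAt.comp_hasDerivWithinAt t hd
  have hd2 : HasDerivWithinAt (fun τ => (u τ).2) v.2 (Icc a b) t :=
    (ContinuousLinearMap.snd ℝ ℂ ℂ).hasFDerivAt.comp_hasDerivWithinAt t hd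
  have h1 := hF a b (fun τ => (u τ).swap) v.swap t hab ht
    (fun τ hτ => swap_mem_spectralCurve (hu τ hτ)) hut (hd2.prodMk hd1)
  rw [thetaForm_swap hε lam (hu t ht)
    (tangent_eq_zero (uniqueDiffOn_Icc hab t ht) ht hu hd)]
  convert! (h1.const_mul (-1)).add (hd1.mul hd2) using 1
  ring

end Symmetry

/-! ### Construction of the Bloch–Jost function -/

theorem exists_blochJost (lam : ℂ) {ε : ℝ} (hε : 4 < ε)
    (hconn : ∀ P Q : spectralCurve ε, Joined P Q) (P₀ : spectralCurve ε)
    (hspec : ∀ γ : UniversalCover P₀,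
      (coverProj γ).1.1 = P₀.1.1 → qMap (coverProj γ) = qMap P₀ → expPeriod lam γ = 1) :
    ∃ f : spectralCurve ε → ℂ, IsBlochJost f ∧
      ∀ γ : UniversalCover P₀, expPeriod lam γ = f (coverProj γ) := by
  set S := thetaSystem hε lam with hS
  have hspec' : ∀ (P : spectralCurve ε) (γ : Path P₀ P), P.1.1 = P₀.1.1 → qMap P = qMap P₀ →
      exp (2 * Real.pi * I * S.period γ) = 1 := by
    intro P γ h1 h2
    rw [← expPeriod_eq hε lam ⟨P, Path.Homotopic.Quotient.mk γ⟩ γ rfl]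
    exact hspec _ h1 h2
  have α : ∀ P, Path P₀ P := fun P => (hconn P₀ P).somePath
  set f : spectralCurve ε → ℂ := fun P => exp (2 * Real.pi * I * S.period (α P)) with hf
  have hfeq : ∀ (P : spectralCurve ε) (γ : Path P₀ P),
      exp (2 * Real.pi * I * S.period γ) = f P := by
    intro P γ
    have h := hspec' P₀ (γ.trans (α P).symm) rfl rfl
    rw [PrimitiveSystem.period_trans, PrimitiveSystem.period_symm, ← sub_eq_add_neg, mul_sub,
      exp_sub] at h
    exact eq_of_div_eq_one h
  have hY : ∀ (Q : spectralCurve ε) (β : Path Q (shiftY Q)),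
      exp (2 * Real.pi * I * S.period β) = 1 := by
    intro Q β
    -- The path β is conjugated by α Q and its y-translate, which have equal periods; the resulting
    -- path starts at P₀, keeps x and shifts y by 1.
    have h := hspec' (shiftY P₀) (((α Q).trans β).trans ((α Q).map continuous_shiftY).symm) rfl
      (Subtype.ext (Prod.ext rfl (by
        change exp (2 * Real.pi * I * (P₀.1.2 + 1)) = exp (2 * Real.pi * I * P₀.1.2)
        rw [mul_add, mul_one, exp_add, exp_two_pi_mul_I, mul_one])))
    rw [PrimitiveSystem.period_trans, PrimitiveSystem.period_trans, PrimitiveSystem.period_symm,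
      ← period_map_shiftY hε lam] at h
    rw [← h]
    congr 2
    ring
  have hX : ∀ σ : Path P₀ (shiftX P₀),
      exp (2 * Real.pi * I * S.period σ) = exp (2 * Real.pi * I * P₀.1.2) := by
    intro σ
    -- The swap turns the x-translate of P₀ into the y-translate of the swapped point,
    -- definitionally.
    have h := hY (swapCurve P₀) (σ.map continuous_swapCurve)
    have e : S.period σ = P₀.1.2 - S.period (σ.map continuous_swapCurve) := by
      rw [hS, period_map_swapCurve]
      simp only [shiftX]
      ring
    rw [e, mul_sub, exp_sub]
    erw [h]
    rw [div_one]
  have hfY : ∀ P, f (shiftY P) = f P := by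
    intro P
    rw [← hfeq _ ((α (shiftY P₀)).trans ((α P).map continuous_shiftY)),
      PrimitiveSystem.period_trans, ← period_map_shiftY hε lam, mul_add, exp_add, hY, one_mul]
  have hfX : ∀ P, f (shiftX P) * exp (-(2 * Real.pi * I * P.1.2)) = f P := by
    intro P
    have e := period_map_shiftX hε lam (α P)
    -- The x-translate of P is reached through the x-translate of P₀; the first leg contributes
    -- P₀.1.2, the second P.1.2 - P₀.1.2 beyond the period of α P.
    rw [← hfeq _ ((α (shiftX P₀)).trans ((α P).map continuous_shiftX)),
      PrimitiveSystem.period_trans, mul_add, exp_add, hX, ← exp_add, ← exp_add]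
    change _ = exp (2 * Real.pi * I * S.period (α P))
    rw [hS, e]
    congr 1
    ring
  refine ⟨f, ⟨fun P => ?_, fun P => (hfX P).trans (hfY P).symm, hfY⟩, fun γ => ?_⟩
  · obtain ⟨c, pr, r, V, ω, h⟩ := exists_isCurveChart hε lam P.2
    obtain ⟨F, hFa, hF⟩ := h.exists_primitive
    -- Extending α P by a path inside the chart changes the period by the increment of the local
    -- primitive.
    refine ⟨fun Q => f P * exp (2 * Real.pi * I * (F Q - F P)), ?_, ?_⟩
    · exact analyticAt_const.mul (analyticAt_const.mul (hFa.sub analyticAt_const)).cexp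
    · filter_upwards [continuous_subtype_val.continuousAt (h.isOpen.mem_nhds h.mem)] with Q hQ
      obtain ⟨δ, hδ⟩ := h.exists_path h.mem hQ
      have hδ' : S.period δ = F Q - F P :=
        PrimitiveSystem.period_eq_of_forall_isPrim δ (F := fun Q : spectralCurve ε => F Q)
          fun t => ⟨F, V, h.isOpen, hδ t, hF, fun _ => rfl⟩
      rw [← hfeq Q ((α P).trans δ), PrimitiveSystem.period_trans, mul_add, exp_add, hδ']
  · obtain ⟨P, γ⟩ := γ
    induction γ using Path.Homotopic.Quotient.ind with
    | mk γ => exact (expPeriod_eq hε lam ⟨P, _⟩ γ rfl).trans (hfeq P γ)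

end

/-! ### Connectedness of the spectral curve -/

noncomputable section

open Filter Set

section Lifting

open unitInterval

theorem exists_continuous_log {g : C(I, ℂ)} (hg : ∀ t, g t ≠ 0) :
    ∃ L : C(I, ℂ), ∀ t, exp (L t) = g t := by
  let γ : C(I, {z : ℂ // z ≠ 0}) := ⟨fun t => ⟨g t, hg t⟩, g.continuous.subtype_mk _⟩
  have h0 : γ 0 = ⟨exp (log (g 0)), exp_ne_zero _⟩ := Subtype.ext (exp_log (hg 0)).symm
  obtain ⟨L, hL, -⟩ := isCoveringMap_exp.exists_path_lifts γ (log (g 0)) h0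
  exact ⟨L, fun t => congrArg Subtype.val (congrFun hL t)⟩

/-- Paths avoiding the critical values `±1` lift through `x ↦ cos 2πx`. -/
theorem exists_lift_cos {p : C(I, ℂ)} (h1 : ∀ t, p t ≠ 1) (h2 : ∀ t, p t ≠ -1) {x : ℂ}
    (hx : cos (2 * Real.pi * x) = p 0) :
    ∃ X : C(I, ℂ), X 0 = x ∧ ∀ t, cos (2 * Real.pi * X t) = p t := by
  obtain ⟨L, hL⟩ := exists_continuous_log (g := p ^ 2 - 1) fun t => by
    change p t ^ 2 - 1 ≠ 0
    rw [sub_ne_zero, Ne, sq_eq_one_iff, not_or]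
    exact ⟨h1 t, h2 t⟩
  have hL' : ∀ t, exp (L t / 2) * exp (L t / 2) = p t ^ 2 - 1 := fun t => by
    rw [← exp_add, add_halves, hL]; rfl
  -- With p = cos 2πx, this is p + √(p² - 1), a continuous choice of e^{2πix}; the conjugate p -
  -- √(p² - 1) is its inverse.
  let g : C(I, ℂ) := ⟨fun t => p t + exp (L t / 2), by fun_prop⟩
  have hmul : ∀ t, g t * (p t - exp (L t / 2)) = 1 := fun t => by
    change (p t + exp (L t / 2)) * (p t - exp (L t / 2)) = 1
    linear_combination -hL' t
  obtain ⟨M, hM⟩ := exists_continuous_log (g := g) fun t => left_ne_zero_of_mul_eq_one (hmul t)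
  let X : C(I, ℂ) := ⟨fun t => M t / (2 * Real.pi * Complex.I),
    M.continuous.div_const _⟩
  have hX : ∀ t, cos (2 * Real.pi * X t) = p t := by
    intro t
    have e : 2 * Real.pi * X t * Complex.I = M t := by
      have := Real.pi_ne_zero
      change 2 * Real.pi * (M t / (2 * Real.pi * Complex.I)) * Complex.I = M t
      field_simp
    rw [cos, neg_mul, e, exp_neg, hM, inv_eq_of_mul_eq_one_right (hmul t)]
    change (p t + exp (L t / 2) + (p t - exp (L t / 2))) / 2 = p t
    ring
  have hx0 : cos (2 * Real.pi * X 0) = cos (2 * Real.pi * x) := by rw [hX, hx]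
  -- The lift need not start at x, but it does so after an integer translation, possibly combined
  -- with a sign change.
  obtain ⟨k, hk | hk⟩ := cos_eq_cos_iff.1 hx0
  · refine ⟨⟨fun t => X t + k, by fun_prop⟩, ?_, fun t => ?_⟩
    · apply mul_left_cancel₀ two_pi_ne_zero'
      rw [hk]
      change 2 * Real.pi * (X 0 + k) = _
      ring
    · rw [← hX t, ← cos_add_int_mul_two_pi (2 * Real.pi * X t) k]
      change cos (2 * Real.pi * (X t + k)) = _
      congr 1; ring
  · refine ⟨⟨fun t => k - X t, by fun_prop⟩, ?_, fun t => ?_⟩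
    · apply mul_left_cancel₀ two_pi_ne_zero'
      rw [hk]
      change 2 * Real.pi * (k - X 0) = _
      ring
    · rw [← hX t, ← cos_neg (2 * Real.pi * X t), ← cos_add_int_mul_two_pi (-(2 * Real.pi * X t)) k]
      change cos (2 * Real.pi * (k - X t)) = _
      congr 1; ring

end Lifting

section Graph

/-- The height `t ≥ 0` with `cosh 2πt = w`. -/
def curveHeight (w : ℝ) : ℝ := Real.arcosh w / (2 * Real.pi)

theorem two_pi_mul_curveHeight (w : ℝ) :
    (2 * Real.pi * (curveHeight w * I) : ℂ) = (Real.arcosh w : ℂ) * I := by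
  have := Real.pi_ne_zero
  rw [curveHeight]
  push_cast
  field_simp

theorem cos_two_pi_curveHeight {w : ℝ} (hw : 1 ≤ w) :
    cos (2 * Real.pi * (curveHeight w * I)) = w := by
  rw [two_pi_mul_curveHeight, cos_mul_I, ← ofReal_cosh, Real.cosh_arcosh hw]

theorem cos_two_pi_sign_add_int {σ : ℂ} (hσ : σ = 1 ∨ σ = -1) (n : ℤ) (z : ℂ) :
    cos (2 * Real.pi * (σ * z + n)) = cos (2 * Real.pi * z) := by
  have : 2 * Real.pi * (σ * z + n) = σ * (2 * Real.pi * z) + n * (2 * Real.pi) := by ring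
  rw [this, cos_add_int_mul_two_pi]
  rcases hσ with rfl | rfl
  · rw [one_mul]
  · rw [neg_one_mul, cos_neg]

theorem exists_eq_sign_add_int {y z : ℂ}
    (h : cos (2 * Real.pi * y) = cos (2 * Real.pi * z)) :
    ∃ σ : ℂ, (σ = 1 ∨ σ = -1) ∧ ∃ n : ℤ, y = σ * z + n := by
  obtain ⟨n, hn | hn⟩ := cos_eq_cos_iff.1 h.symm
  · refine ⟨1, .inl rfl, n, mul_left_cancel₀ two_pi_ne_zero' ?_⟩
    rw [hn]; ring
  · refine ⟨-1, .inr rfl, n, mul_left_cancel₀ two_pi_ne_zero' ?_⟩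
    rw [hn]; ring

variable {ε : ℝ}

/-- The set of `x` for which `cos 2πx` is real and at most `ε / 2 - 1`. -/
def graphDomain (ε : ℝ) : Set ℂ :=
  {x | ∃ k : ℝ, cos (2 * Real.pi * x) = k ∧ k ≤ ε / 2 - 1}

/-- A branch over `graphDomain ε` of the function `y` on the spectral curve. -/
def graphFun (ε : ℝ) (σ : ℂ) (n : ℤ) (x : ℂ) : ℂ :=
  σ * (curveHeight (ε / 2 - (cos (2 * Real.pi * x)).re) * I) + n

theorem continuousOn_graphFun (σ : ℂ) (n : ℤ) :
    ContinuousOn (graphFun ε σ n) (graphDomain ε) := by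
  have h1 : ContinuousOn (fun x : ℂ => Real.arcosh (ε / 2 - (cos (2 * Real.pi * x)).re))
      (graphDomain ε) := by
    refine Real.continuousOn_arcosh.comp (Continuous.continuousOn ?_) ?_
    · exact continuous_const.sub (continuous_re.comp (continuous_cos.comp (by fun_prop)))
    · rintro x ⟨k, hk, hk'⟩
      dsimp only
      rw [mem_Ici, hk, ofReal_re]
      linarith
  unfold graphFun curveHeight
  exact (continuousOn_const.mul ((continuous_ofReal.comp_continuousOn
    (h1.div_const _)).mul continuousOn_const)).add continuousOn_const

theorem cos_graphFun {σ : ℂ} (hσ : σ = 1 ∨ σ = -1) (n : ℤ) {x : ℂ} (hx : x ∈ graphDomain ε) :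
    cos (2 * Real.pi * graphFun ε σ n x) = ε / 2 - cos (2 * Real.pi * x) := by
  obtain ⟨k, hk, hk'⟩ := hx
  rw [graphFun, cos_two_pi_sign_add_int hσ, hk, ofReal_re, cos_two_pi_curveHeight (by linarith)]
  push_cast
  rfl

theorem joinedIn_graph {σ : ℂ} (hσ : σ = 1 ∨ σ = -1) (n : ℤ) {x x' : ℂ}
    (h : JoinedIn (graphDomain ε) x x') :
    JoinedIn (spectralCurve ε) (x, graphFun ε σ n x) (x', graphFun ε σ n x') := by
  refine (h.map_continuousOn (f := fun x => (x, graphFun ε σ n x))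
    (continuousOn_id.prodMk (continuousOn_graphFun σ n))).mono ?_
  rintro _ ⟨z, hz, rfl⟩
  rw [mem_spectralCurve, cos_graphFun hσ n hz]
  ring

theorem ofReal_mem_graphDomain (hε : 4 < ε) (x : ℝ) : (x : ℂ) ∈ graphDomain ε := by
  refine ⟨Real.cos (2 * Real.pi * x), by push_cast; rfl, ?_⟩
  linarith [Real.cos_le_one (2 * Real.pi * x)]

theorem joinedIn_ofReal (hε : 4 < ε) (x y : ℝ) : JoinedIn (graphDomain ε) x y := by
  have := (PathConnectedSpace.joined x y)
  obtain ⟨γ⟩ := this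
  exact ⟨γ.map continuous_ofReal, fun t => ofReal_mem_graphDomain hε (γ t)⟩

theorem cos_crossing {σ : ℂ} (hε : 4 < ε) (hσ : σ = 1 ∨ σ = -1) (m : ℤ) :
    cos (2 * Real.pi * (σ * (curveHeight (ε / 4) * I) + m)) = (ε / 4 : ℝ) := by
  rw [cos_two_pi_sign_add_int hσ, cos_two_pi_curveHeight (by linarith)]

/-- Descend vertically to the integer m, where the cosine stays real and at most ε / 4 ≤ ε / 2 - 1,
then follow the real axis. -/
theorem joinedIn_crossing {σ : ℂ} (hε : 4 < ε) (hσ : σ = 1 ∨ σ = -1) (m : ℤ) :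
    JoinedIn (graphDomain ε) (σ * (curveHeight (ε / 4) * I) + m) 0 := by
  refine JoinedIn.trans (y := ((m : ℝ) : ℂ)) ?_ (joinedIn_ofReal hε m 0)
  refine JoinedIn.ofLine (f := fun t : ℝ =>
    σ * (((1 - t) * curveHeight (ε / 4) : ℝ) * I) + m) (by fun_prop) (by simp) (by simp) ?_
  rintro _ ⟨t, ht, rfl⟩
  refine ⟨Real.cosh (2 * Real.pi * ((1 - t) * curveHeight (ε / 4))), ?_, ?_⟩
  · rw [cos_two_pi_sign_add_int hσ, ← mul_assoc, cos_mul_I]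
    push_cast
    rfl
  · have h1 : Real.cosh (2 * Real.pi * curveHeight (ε / 4)) = ε / 4 := by
      rw [curveHeight, mul_div_cancel₀ _ (by positivity), Real.cosh_arcosh (by linarith)]
    have h2 : Real.cosh (2 * Real.pi * ((1 - t) * curveHeight (ε / 4))) ≤
        Real.cosh (2 * Real.pi * curveHeight (ε / 4)) := by
      rw [Real.cosh_le_cosh]
      have h3 : |1 - t| ≤ 1 := abs_le.2 ⟨by linarith [ht.2], by linarith [ht.1]⟩
      rw [abs_mul, abs_mul (2 * Real.pi), abs_mul (1 - t)]
      exact mul_le_mul_of_nonneg_left (mul_le_of_le_one_left (abs_nonneg _) h3) (abs_nonneg _)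
    linarith

theorem joinedIn_swap {P Q : ℂ × ℂ} (h : JoinedIn (spectralCurve ε) P Q) :
    JoinedIn (spectralCurve ε) P.swap Q.swap := by
  refine (h.map continuous_swap).mono ?_
  rintro _ ⟨R, hR, rfl⟩
  exact swap_mem_spectralCurve hR

theorem graphFun_crossing {σ σ' : ℂ} (hε : 4 < ε) (hσ : σ = 1 ∨ σ = -1) (m n : ℤ) :
    graphFun ε σ' n (σ * (curveHeight (ε / 4) * I) + m) =
      σ' * (curveHeight (ε / 4) * I) + n := by
  rw [graphFun, cos_crossing hε hσ, ofReal_re]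
  congr 5
  ring

/-- Both points are joined to the point where cos 2πx = cos 2πy = ε / 4 with the prescribed signs
and integers. As these are arbitrary, all branches become connected. -/
theorem joinedIn_axes (hε : 4 < ε) {σ σ' : ℂ} (hσ : σ = 1 ∨ σ = -1) (hσ' : σ' = 1 ∨ σ' = -1)
    (m n : ℤ) : JoinedIn (spectralCurve ε) (0, graphFun ε σ m 0) (graphFun ε σ' n 0, 0) := by
  have h1 := joinedIn_graph hσ m (joinedIn_crossing hε hσ' n)
  have h2 := joinedIn_swap (joinedIn_graph hσ' n (joinedIn_crossing hε hσ m))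
  rw [graphFun_crossing hε hσ'] at h1
  rw [graphFun_crossing hε hσ] at h2
  exact h1.symm.trans h2

theorem joinedIn_base_of_joinedIn (hε : 4 < ε) {P : ℂ × ℂ} (hP : P ∈ spectralCurve ε)
    (h : JoinedIn (graphDomain ε) P.1 0) :
    JoinedIn (spectralCurve ε) P (0, graphFun ε 1 0 0) := by
  have hD := h.source_mem
  have h1 : cos (2 * Real.pi * P.2) = cos (2 * Real.pi * graphFun ε 1 0 P.1) := by
    rw [cos_graphFun (.inl rfl) 0 hD]
    rw [mem_spectralCurve] at hP
    linear_combination hP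
  obtain ⟨σ, hσ, n, hn⟩ := exists_eq_sign_add_int h1
  have h2 : P.2 = graphFun ε σ n P.1 := by
    rw [hn, graphFun, graphFun]
    push_cast
    ring
  have h3 := joinedIn_graph hσ n h
  rw [← h2] at h3
  exact h3.trans ((joinedIn_axes hε hσ (.inl rfl) n 0).trans
    (joinedIn_axes hε (.inl rfl) (.inl rfl) 0 0).symm)

theorem joinedIn_zero_of_sin_eq_zero (hε : 4 < ε) {x : ℂ} (hx : sin (2 * Real.pi * x) = 0) :
    JoinedIn (graphDomain ε) x 0 := by
  obtain ⟨k, hk⟩ := sin_eq_zero_iff.1 hx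
  have : x = ((k / 2 : ℝ) : ℂ) := by
    apply mul_left_cancel₀ two_pi_ne_zero'
    rw [hk]
    push_cast
    ring
  rw [this]
  exact joinedIn_ofReal hε _ 0

theorem joinedIn_base (hε : 4 < ε) {P : ℂ × ℂ} (hP : P ∈ spectralCurve ε) :
    JoinedIn (spectralCurve ε) P (0, graphFun ε 1 0 0) := by
  by_cases hs1 : sin (2 * Real.pi * P.1) = 0
  · exact joinedIn_base_of_joinedIn hε hP (joinedIn_zero_of_sin_eq_zero hε hs1)
  by_cases hs2 : sin (2 * Real.pi * P.2) = 0
  · have h1 := joinedIn_swap (joinedIn_base_of_joinedIn hε (P := P.swap)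
      (swap_mem_spectralCurve hP) (joinedIn_zero_of_sin_eq_zero hε hs2))
    exact h1.trans (joinedIn_axes hε (.inl rfl) (.inl rfl) 0 0).symm
  have hcos : ∀ z : ℂ, sin z ≠ 0 → cos z ≠ 1 ∧ cos z ≠ -1 := by
    intro z hz
    rw [← not_or, ← sq_eq_one_iff]
    intro h
    have := sin_sq_add_cos_sq z
    rw [h, add_eq_right, sq_eq_zero_iff] at this
    exact hz this
  -- In terms of p = cos 2πx, these are the branch values: cos 2πx = ±1, and cos 2πy = ±1 with cos
  -- 2πy = ε / 2 - p. Off them a path of p lifts to x and y simultaneously.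
  set B : Set ℂ := {1, -1, (ε : ℂ) / 2 - 1, (ε : ℂ) / 2 + 1} with hB
  have hBc : IsPathConnected Bᶜ :=
    Set.Countable.isPathConnected_compl_of_one_lt_rank (rank_real_complex ▸ Nat.one_lt_ofNat)
      (toFinite B).countable
  have hpB : cos (2 * Real.pi * P.1) ∈ Bᶜ := by
    have hP' := mem_spectralCurve.1 hP
    have h1 := hcos _ hs1
    have h2 := hcos _ hs2
    simp only [hB, mem_compl_iff, mem_insert_iff, mem_singleton_iff, not_or]
    refine ⟨h1.1, h1.2, fun h => h2.1 ?_, fun h => h2.2 ?_⟩ <;> linear_combination hP' - h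
  have hcB : ((ε / 4 : ℝ) : ℂ) ∈ Bᶜ := by
    simp only [hB, mem_compl_iff, mem_insert_iff, mem_singleton_iff, not_or]
    refine ⟨?_, ?_, ?_, ?_⟩ <;> intro h <;> have := congrArg re h <;> norm_num at this <;> linarith
  obtain ⟨p, hp⟩ := hBc.joinedIn _ hpB _ hcB
  simp only [hB, mem_compl_iff, mem_insert_iff, mem_singleton_iff, not_or] at hp
  obtain ⟨X, hX0, hX⟩ := exists_lift_cos (p := p) (fun t => (hp t).1) (fun t => (hp t).2.1)
    (x := P.1) (by simp)
  obtain ⟨Y, hY0, hY⟩ := exists_lift_cos (p := ⟨fun t => (ε : ℂ) / 2 - p t, by fun_prop⟩)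
    (fun t h => (hp t).2.2.1 (by
      change (ε : ℂ) / 2 - p t = 1 at h
      linear_combination -h))
    (fun t h => (hp t).2.2.2 (by
      change (ε : ℂ) / 2 - p t = -1 at h
      linear_combination -h))
    (x := P.2) (by
      change _ = (ε : ℂ) / 2 - p 0
      rw [p.source]
      linear_combination mem_spectralCurve.1 hP)
  have hmem : ∀ t, (X t, Y t) ∈ spectralCurve ε := fun t => by
    rw [mem_spectralCurve, hX, hY]
    exact add_sub_cancel _ _
  have hjoin : JoinedIn (spectralCurve ε) P (X 1, Y 1) :=
    ⟨⟨⟨fun t => (X t, Y t), by fun_prop⟩, Prod.ext hX0 hY0, rfl⟩, hmem⟩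
  refine hjoin.trans (joinedIn_base_of_joinedIn hε (hmem 1) ?_)
  have h1 : cos (2 * Real.pi * X 1) = cos (2 * Real.pi * (curveHeight (ε / 4) * I)) := by
    rw [hX, cos_two_pi_curveHeight (by linarith)]
    exact p.target
  obtain ⟨σ, hσ, n, hn⟩ := exists_eq_sign_add_int h1
  rw [hn]
  exact joinedIn_crossing hε hσ n

theorem joined_spectralCurve (hε : 4 < ε) (P Q : spectralCurve ε) : Joined P Q :=
  ((joinedIn_base hε P.2).trans (joinedIn_base hε Q.2).symm).joined_subtype

end Graph

end

theorem mainTheorem6 (lam : ℂ) (ε : ℝ) (hε : 4 < ε) (P₀ : spectralCurve ε)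
    (hspec : ∀ γ : UniversalCover P₀,
      (coverProj γ).1.1 = P₀.1.1 → qMap (coverProj γ) = qMap P₀ → expPeriod lam γ = 1) :
    ∃ f : spectralCurve ε → ℂ, IsBlochJost f ∧
      ∀ γ : UniversalCover P₀, expPeriod lam γ = f (coverProj γ) :=
  exists_blochJost lam hε (joined_spectralCurve hε) P₀ hspec
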